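/- **Definitions.** A *finite-dimensional operator space* is a finite-dimensional complex vector space $X$ with a norm $\|\cdot\|_n$ on each matrix space $\mathbb M_n(X)$ such that $\|x\oplus y\|_{m+n}=\max\{\|x\|_m,\|y\|_n\}$ and $\|\alpha x\beta\|_m\le\|\alpha\|\,\|x\|_m\,\|\beta\|$ for $x\in\mathbb M_m(X)$, $y\in\mathbb M_n(X)$ and complex $m\times m$ matrices $\alpha,\beta$ (with the operator norm). A linear map $\varphi:X\to Y$ is a *complete contraction* if every amplification $\varphi_n:\mathbb M_n(X)\to\mathbb M_n(Y)$, $[x_{ij}]\mapsto[\varphi(x_{ij})]$, is a contraction; $\|\varphi\|_{cb}=\sup_n\|\varphi_n\|$. Let $\mathbf{FdOS}$ be the category of finite-dimensional operator spaces and complete contractions. We use the following objects. * $\mathbb C$, with the operator norms on $\mathbb M_n(\mathbb C)$, and the zero-dimensional space $0$. * $CB(X,Y)$: the space of all linear maps $X\to Y$, with the matrix norms given by $\mathbb M_n(CB(X,Y))\cong CB(X,M_n(Y))$ and the cb-norm, where $M_n(Y)$ has the matrix norms given by $\mathbb M_m(\mathbb M_n(Y))\cong\mathbb M_{mn}(Y)$.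 The dual is $X^*=CB(X,\mathbb C)$. * $X\oplus^\infty Y$: the space $X\oplus Y$ with $\|z\|=\max\{\|x\|,\|y\|\}$ for $z=(x,y)\in\mathbb M_n(X\oplus Y)\cong\mathbb M_n(X)\oplus\mathbb M_n(Y)$. * $X\oplus^1 Y$: the space $X\oplus Y$ with the structure inherited from $X\oplus Y\cong(X^*\oplus^\infty Y^*)^*$, $(x,y)\mapsto\big((f,g)\mapsto f(x)+g(y)\big)$. * The completely injective tensor product $X\check\otimes Y$: the space $X\otimes Y$ with the structure inherited from $X\otimes Y\cong CB(Y^*,X)$, $x\otimes y\mapsto(f\mapsto f(y)x)$. * The completely projective tensor product $X\hat\otimes Y$: the space $X\otimes Y$ with the structure inherited from $X\otimes Y\cong(X^*\check\otimes Y^*)^*$, $x\otimes y\mapsto\big(f\otimes g\mapsto f(x)g(y)\big)$. A symmetric monoidal closed category is *$*$-autonomous with dualizing object $\bot$* if for every object $A$ the canonical morphism $A\to(A\multimap\bot)\multimap\bot$ is an isomorphism; its par is the bifunctor $A\parr B=(A\multimap\bot)\multimap B$. A *model of MALL* is a $*$-autonomous category with finite products and finite coproducts. **Theorem.** 1. $0$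 is a zero object of $\mathbf{FdOS}$; $X\oplus^\infty Y$ with the coordinate projections is a product of $X$ and $Y$; $X\oplus^1Y$ with the coordinate injections is a coproduct of $X$ and $Y$. Hence $\mathbf{FdOS}$ has finite products and finite coproducts. 2. Each of $\hat\otimes$ and $\check\otimes$ makes $\mathbf{FdOS}$ a symmetric monoidal category with unit $\mathbb C$, where the action on morphisms, the associators, the unitors and the symmetries are those of the tensor product of vector spaces. 3. $(\mathbf{FdOS},\hat\otimes,\mathbb C)$ is closed, with internal hom $CB(X,Y)$ and the usual evaluation maps $x\otimes\varphi\mapsto\varphi(x)$, and it is $*$-autonomous with dualizing object $\mathbb C$. 4. Its par is $\check\otimes$: the map $x\otimes y\mapsto(f\mapsto f(x)y)$ is an isomorphism $X\check\otimes Y\cong X\parr Y=CB(X^*,Y)$ in $\mathbf{FdOS}$, natural in $X$ and $Y$. Consequently $\mathbf{FdOS}$ is a model of MALL. -/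

import Mathlib

open scoped Matrix.Norms.L2Operator TensorProduct Kronecker

/-! ### Matrices over a complex vector space -/

section MatrixSpace

/-- The product `α x β` of a matrix `x` over a complex vector space with complex matrices
`α`, `β`. -/
def sandwich {V ι κ : Type*} [AddCommGroup V] [Module ℂ V] [Fintype ι]
    (α : Matrix κ ι ℂ) (x : Matrix ι ι V) (β : Matrix ι κ ℂ) : Matrix κ κ V :=
  fun i j => ∑ k, ∑ l, (α i k * β l j) • x k l

/-- The block diagonal matrix `x ⊕ y`. -/
def directSum {V : Type*} [AddCommGroup V] {m n : ℕ}
    (x : Matrix (Fin m) (Fin m) V) (y : Matrix (Fin n) (Fin n) V) :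
    Matrix (Fin (m + n)) (Fin (m + n)) V :=
  (Matrix.fromBlocks x 0 0 y).submatrix finSumFinEquiv.symm finSumFinEquiv.symm

end MatrixSpace

/-- An operator space structure on a complex vector space `V`: norms on all the matrix spaces
`𝕄ₙ(V)` satisfying Ruan's axioms, where complex matrices carry the operator norm. (The space of
matrices of size `0` is trivial, so that including `n = 0` is harmless.  Completeness of
`𝕄₁(V)` is automatic for the finite-dimensional spaces considered below.) -/
structure OperatorSpaceStructure (V : Type*) [AddCommGroup V] [Module ℂ V] where
  /-- the norm on `𝕄ₙ(V)` -/
  nrm : ∀ n : ℕ, Seminorm ℂ (Matrix (Fin n) (Fin n) V)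
  definite : ∀ (n : ℕ) (x : Matrix (Fin n) (Fin n) V), nrm n x = 0 → x = 0
  nrm_directSum : ∀ (m n : ℕ) (x : Matrix (Fin m) (Fin m) V) (y : Matrix (Fin n) (Fin n) V),
    nrm (m + n) (directSum x y) = max (nrm m x) (nrm n y)
  nrm_sandwich_le : ∀ (n : ℕ) (α : Matrix (Fin n) (Fin n) ℂ) (x : Matrix (Fin n) (Fin n) V)
    (β : Matrix (Fin n) (Fin n) ℂ), nrm n (sandwich α x β) ≤ ‖α‖ * nrm n x * ‖β‖

/-! ### Norms of scalar matrices -/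

section ScalarMatrix

theorem norm_col_le {ι : Type*} [Fintype ι] (v : EuclideanSpace ℂ ι) :
    ‖(Matrix.of fun i (_ : Unit) => v i : Matrix ι Unit ℂ)‖ ≤ ‖v‖ := by
  rw [Matrix.l2_opNorm_def]
  refine ContinuousLinearMap.opNorm_le_bound _ (norm_nonneg _) fun x => le_of_eq ?_
  have : ((Matrix.toEuclideanLin.trans LinearMap.toContinuousLinearMap)
      (Matrix.of fun i (_ : Unit) => v i : Matrix ι Unit ℂ)) x = x () • v := by
    ext i
    simp [Matrix.toEuclideanLin, Matrix.mulVec, dotProduct, mul_comm]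
  rw [this, norm_smul, mul_comm]
  congr 1
  simp [EuclideanSpace.norm_eq]

variable {ι κ : Type*} [Fintype ι] [DecidableEq ι] [Fintype κ] [DecidableEq κ]

theorem norm_submatrix_equiv_le (e : κ ≃ ι) (A : Matrix ι ι ℂ) : ‖A.submatrix e e‖ ≤ ‖A‖ := by
  let φ : Matrix ι ι ℂ →⋆ₙₐ[ℂ] Matrix κ κ ℂ :=
    { toFun := fun A => A.submatrix e e
      map_smul' := fun _ _ => rfl
      map_zero' := rfl
      map_add' := fun _ _ => rfl
      map_mul' := fun A B => (Matrix.submatrix_mul_equiv A B e e e).symm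
      map_star' := fun _ => rfl }
  exact NonUnitalStarAlgHom.norm_apply_le φ A

theorem norm_fromBlocks_diag (x : Matrix ι ι ℂ) (y : Matrix κ κ ℂ) :
    ‖Matrix.fromBlocks x 0 0 y‖ = max ‖x‖ ‖y‖ := by
  let φ : (Matrix ι ι ℂ × Matrix κ κ ℂ) →⋆ₙₐ[ℂ] Matrix (ι ⊕ κ) (ι ⊕ κ) ℂ :=
    { toFun := fun p => Matrix.fromBlocks p.1 0 0 p.2
      map_smul' := fun c p => by simp [Matrix.fromBlocks_smul]
      map_zero' := by simp
      map_add' := fun p q => by simp [Matrix.fromBlocks_add]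
      map_mul' := fun p q => by simp [Matrix.fromBlocks_multiply]
      map_star' := fun p => by
        simp [Matrix.star_eq_conjTranspose, Matrix.fromBlocks_conjTranspose] }
  have h := NonUnitalStarAlgHom.norm_map φ (fun p q h => by
    have := Matrix.fromBlocks_inj.1 h
    exact Prod.ext this.1 this.2.2.2) (x, y)
  exact h

theorem norm_one_kronecker_le (A : Matrix ι ι ℂ) : ‖(1 : Matrix κ κ ℂ) ⊗ₖ A‖ ≤ ‖A‖ := by
  let φ : Matrix ι ι ℂ →⋆ₙₐ[ℂ] Matrix (κ × ι) (κ × ι) ℂ :=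
    { toFun := fun A => (1 : Matrix κ κ ℂ) ⊗ₖ A
      map_smul' := fun c p => by simp [Matrix.kronecker_smul]
      map_zero' := by simp
      map_add' := fun p q => by simp [Matrix.kronecker_add]
      map_mul' := fun p q => by simp [← Matrix.mul_kronecker_mul]
      map_star' := fun p => by
        simp [Matrix.star_eq_conjTranspose, Matrix.conjTranspose_kronecker] }
  exact NonUnitalStarAlgHom.norm_apply_le φ A

theorem norm_kronecker_one_le (A : Matrix ι ι ℂ) : ‖A ⊗ₖ (1 : Matrix κ κ ℂ)‖ ≤ ‖A‖ := by
  let φ : Matrix ι ι ℂ →⋆ₙₐ[ℂ] Matrix (ι × κ) (ι × κ) ℂ :=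
    { toFun := fun A => A ⊗ₖ (1 : Matrix κ κ ℂ)
      map_smul' := fun c p => by simp [Matrix.smul_kronecker]
      map_zero' := by simp
      map_add' := fun p q => by simp [Matrix.add_kronecker]
      map_mul' := fun p q => by simp [← Matrix.mul_kronecker_mul]
      map_star' := fun p => by
        simp [Matrix.star_eq_conjTranspose, Matrix.conjTranspose_kronecker] }
  exact NonUnitalStarAlgHom.norm_apply_le φ A

theorem norm_le_one_of_conjTranspose_mul_self {A : Matrix ι ι ℂ} (h : A.conjTranspose * A = 1) :
    ‖A‖ ≤ 1 := by
  have h1 : ‖(1 : Matrix ι ι ℂ)‖ ≤ 1 := by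
    rw [← Matrix.diagonal_one, Matrix.l2_opNorm_diagonal]
    exact (pi_norm_le_iff_of_nonneg zero_le_one).2 (fun _ => by simp)
  have h2 := Matrix.l2_opNorm_conjTranspose_mul_self A
  rw [h] at h2
  nlinarith [norm_nonneg A]

theorem norm_fromBlocks_lower_le (α : Matrix κ ι ℂ) :
    ‖(Matrix.fromBlocks 0 0 α 0 : Matrix (ι ⊕ κ) (ι ⊕ κ) ℂ)‖ ≤ ‖α‖ := by
  have h := Matrix.l2_opNorm_conjTranspose_mul_self
    (Matrix.fromBlocks 0 0 α 0 : Matrix (ι ⊕ κ) (ι ⊕ κ) ℂ)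
  have h' : (Matrix.fromBlocks 0 0 α 0 : Matrix (ι ⊕ κ) (ι ⊕ κ) ℂ).conjTranspose *
      Matrix.fromBlocks 0 0 α 0 = Matrix.fromBlocks (α.conjTranspose * α) 0 0 0 := by
    simp [Matrix.fromBlocks_conjTranspose, Matrix.fromBlocks_multiply]
  rw [h', norm_fromBlocks_diag, norm_zero, max_eq_left (norm_nonneg _),
    Matrix.l2_opNorm_conjTranspose_mul_self] at h
  by_contra! hlt
  nlinarith [norm_nonneg α]

theorem norm_fromBlocks_upper_le (β : Matrix ι κ ℂ) :
    ‖(Matrix.fromBlocks 0 β 0 0 : Matrix (ι ⊕ κ) (ι ⊕ κ) ℂ)‖ ≤ ‖β‖ := by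
  have h := norm_fromBlocks_lower_le β.conjTranspose
  rw [Matrix.l2_opNorm_conjTranspose] at h
  rw [← Matrix.l2_opNorm_conjTranspose]
  simpa [Matrix.fromBlocks_conjTranspose] using h

theorem norm_le_of_forall_sesq {A : Matrix ι ι ℂ} {C : ℝ} (hC : 0 ≤ C)
    (h : ∀ ξ η : EuclideanSpace ℂ ι,
      ‖∑ i, ∑ j, star (ξ i) * A i j * η j‖ ≤ C * ‖ξ‖ * ‖η‖) : ‖A‖ ≤ C := by
  rw [Matrix.l2_opNorm_def]
  refine ContinuousLinearMap.opNorm_le_bound _ hC fun η => ?_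
  set ξ := ((Matrix.toEuclideanLin.trans LinearMap.toContinuousLinearMap) A) η with hξ
  have h1 : (∑ i, ∑ j, star (ξ i) * A i j * η j) = ((‖ξ‖ ^ 2 : ℝ) : ℂ) := by
    rw [EuclideanSpace.norm_sq_eq]
    push_cast
    refine Finset.sum_congr rfl fun i _ => ?_
    have : ξ i = ∑ j, A i j * η j := by
      simp [hξ, Matrix.toEuclideanLin, Matrix.mulVec, dotProduct]
    simp_rw [mul_assoc]
    rw [← Finset.mul_sum, ← this, ← starRingEnd_apply, mul_comm, RCLike.mul_conj]
    norm_cast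
  have h2 := h ξ η
  rw [h1, Complex.norm_real, Real.norm_of_nonneg (sq_nonneg _)] at h2
  rcases (norm_nonneg ξ).eq_or_lt with h0 | h0
  · rw [← h0]; positivity
  · nlinarith

end ScalarMatrix

/-! ### Matrix norms over arbitrary finite index types -/

namespace OperatorSpaceStructure

variable {V : Type*} [AddCommGroup V] [Module ℂ V] (E : OperatorSpaceStructure V)

theorem nrm_perm_le {n : ℕ} (σ : Equiv.Perm (Fin n)) (x : Matrix (Fin n) (Fin n) V) :
    E.nrm n (x.submatrix σ σ) ≤ E.nrm n x := by
  let P : Matrix (Fin n) (Fin n) ℂ := Matrix.of fun i k => if k = σ i then 1 else 0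
  have hP : P * P.conjTranspose = 1 := by
    ext i j
    simp [P, Matrix.mul_apply, Matrix.one_apply, eq_comm]
  have hP' : ‖P.conjTranspose‖ ≤ 1 :=
    norm_le_one_of_conjTranspose_mul_self (by simpa using hP)
  have hP'' : ‖P‖ ≤ 1 := by rwa [Matrix.l2_opNorm_conjTranspose] at hP'
  have hx : x.submatrix σ σ = sandwich P x P.conjTranspose := by
    ext i j
    simp [sandwich, P]
  rw [hx]
  refine (E.nrm_sandwich_le n P x _).trans ?_
  have h0 : 0 ≤ E.nrm n x := apply_nonneg _ _
  calc ‖P‖ * E.nrm n x * ‖P.conjTranspose‖ ≤ 1 * E.nrm n x * 1 := by gcongr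
    _ = E.nrm n x := by ring

theorem nrm_perm {n : ℕ} (σ : Equiv.Perm (Fin n)) (x : Matrix (Fin n) (Fin n) V) :
    E.nrm n (x.submatrix σ σ) = E.nrm n x := by
  refine le_antisymm (E.nrm_perm_le σ x) ?_
  have h := E.nrm_perm_le σ.symm (x.submatrix σ σ)
  simpa [Matrix.submatrix_submatrix] using h

/-- The norm of a matrix indexed by an arbitrary finite type. -/
noncomputable def mnorm {ι : Type*} [Fintype ι] (x : Matrix ι ι V) : ℝ :=
  E.nrm (Fintype.card ι) (x.submatrix (Fintype.equivFin ι).symm (Fintype.equivFin ι).symm)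

section

variable {ι κ : Type*} [Fintype ι] [Fintype κ]

theorem mnorm_eq {n : ℕ} (e : ι ≃ Fin n) (x : Matrix ι ι V) :
    E.mnorm x = E.nrm n (x.submatrix e.symm e.symm) := by
  obtain rfl : n = Fintype.card ι := by simpa using (Fintype.card_congr e).symm
  unfold mnorm
  rw [← E.nrm_perm ((Fintype.equivFin ι).symm.trans e) (x.submatrix e.symm e.symm)]
  congr 1
  ext i j
  simp

theorem mnorm_fin {n : ℕ} (x : Matrix (Fin n) (Fin n) V) : E.mnorm x = E.nrm n x :=
  E.mnorm_eq (Equiv.refl _) x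

theorem mnorm_reindex (e : κ ≃ ι) (x : Matrix ι ι V) :
    E.mnorm (x.submatrix e e) = E.mnorm x := by
  rw [E.mnorm_eq (e.trans (Fintype.equivFin ι))]
  unfold mnorm
  congr 1
  ext i j
  simp

theorem mnorm_nonneg (x : Matrix ι ι V) : 0 ≤ E.mnorm x := apply_nonneg _ _

theorem mnorm_zero : E.mnorm (0 : Matrix ι ι V) = 0 := map_zero (E.nrm _)

theorem mnorm_add_le (x y : Matrix ι ι V) : E.mnorm (x + y) ≤ E.mnorm x + E.mnorm y :=
  map_add_le_add (E.nrm _) _ _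

theorem mnorm_smul (c : ℂ) (x : Matrix ι ι V) : E.mnorm (c • x) = ‖c‖ * E.mnorm x :=
  map_smul_eq_mul (E.nrm _) c _

theorem mnorm_sum_le {τ : Type*} (s : Finset τ) (x : τ → Matrix ι ι V) :
    E.mnorm (∑ t ∈ s, x t) ≤ ∑ t ∈ s, E.mnorm (x t) := by
  classical
  induction s using Finset.induction_on with
  | empty => simp [mnorm_zero]
  | insert a s ha ih =>
    rw [Finset.sum_insert ha, Finset.sum_insert ha]
    exact (E.mnorm_add_le _ _).trans (by gcongr)

theorem eq_zero_of_mnorm {x : Matrix ι ι V} (h : E.mnorm x = 0) : x = 0 := by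
  have h' := E.definite _ _ h
  ext i j
  simpa using congrFun (congrFun h' (Fintype.equivFin ι i)) (Fintype.equivFin ι j)

theorem mnorm_fromBlocks (x : Matrix ι ι V) (y : Matrix κ κ V) :
    E.mnorm (Matrix.fromBlocks x 0 0 y) = max (E.mnorm x) (E.mnorm y) := by
  rw [E.mnorm_eq ((Equiv.sumCongr (Fintype.equivFin ι) (Fintype.equivFin κ)).trans
    finSumFinEquiv)]
  unfold mnorm
  rw [← E.nrm_directSum]
  congr 1
  ext i j
  rcases hi : finSumFinEquiv.symm i with a | a <;>
    rcases hj : finSumFinEquiv.symm j with b | b <;> simp [directSum, hi, hj]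

theorem mnorm_sandwich_le [DecidableEq ι] (α : Matrix ι ι ℂ) (x : Matrix ι ι V)
    (β : Matrix ι ι ℂ) : E.mnorm (sandwich α x β) ≤ ‖α‖ * E.mnorm x * ‖β‖ := by
  set e := (Fintype.equivFin ι).symm with he
  have h := E.nrm_sandwich_le _ (α.submatrix e e) (x.submatrix e e) (β.submatrix e e)
  have h' : sandwich (α.submatrix e e) (x.submatrix e e) (β.submatrix e e) =
      (sandwich α x β).submatrix e e := by
    ext i j
    simp only [sandwich, Matrix.submatrix_apply]
    rw [← Equiv.sum_comp e]
    refine Finset.sum_congr rfl fun k _ => ?_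
    rw [← Equiv.sum_comp e]
  rw [h'] at h
  refine h.trans ?_
  have h1 := norm_submatrix_equiv_le e α
  have h2 := norm_submatrix_equiv_le e β
  have h3 : 0 ≤ E.nrm _ (x.submatrix e e) := apply_nonneg _ _
  change _ ≤ ‖α‖ * E.nrm _ (x.submatrix e e) * ‖β‖
  gcongr

theorem mnorm_sandwich_le' [DecidableEq ι] [DecidableEq κ] (α : Matrix κ ι ℂ) (x : Matrix ι ι V)
    (β : Matrix ι κ ℂ) : E.mnorm (sandwich α x β) ≤ ‖α‖ * E.mnorm x * ‖β‖ := by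
  have h := E.mnorm_sandwich_le (Matrix.fromBlocks 0 0 α 0 : Matrix (ι ⊕ κ) (ι ⊕ κ) ℂ)
    (Matrix.fromBlocks x 0 0 0) (Matrix.fromBlocks 0 β 0 0)
  have h' : sandwich (Matrix.fromBlocks 0 0 α 0 : Matrix (ι ⊕ κ) (ι ⊕ κ) ℂ)
    (Matrix.fromBlocks x 0 0 0) (Matrix.fromBlocks 0 β 0 0) =
      Matrix.fromBlocks 0 0 0 (sandwich α x β) := by
    ext i j
    rcases i with i | i <;> rcases j with j | j <;> simp [sandwich]
  rw [h', mnorm_fromBlocks, mnorm_fromBlocks, mnorm_zero, mnorm_zero,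
    max_eq_right (mnorm_nonneg _ _), max_eq_left (mnorm_nonneg _ _)] at h
  refine h.trans ?_
  have h1 := norm_fromBlocks_lower_le α
  have h2 := norm_fromBlocks_upper_le β
  have h3 := E.mnorm_nonneg x
  gcongr

theorem mnorm_diagonal_le [DecidableEq ι] (v : V) :
    E.mnorm (Matrix.diagonal fun _ : ι => v) ≤ E.mnorm (Matrix.of fun _ _ : Unit => v) := by
  have key : ∀ n : ℕ, E.mnorm (Matrix.diagonal fun _ : Fin n => v) ≤
      E.mnorm (Matrix.of fun _ _ : Unit => v) := by
    intro n
    induction n with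
    | zero =>
      have : (Matrix.diagonal fun _ : Fin 0 => v) = 0 := by ext i; exact i.elim0
      rw [this, mnorm_zero]
      exact mnorm_nonneg _ _
    | succ n ih =>
      let e : Fin (n + 1) ≃ Fin n ⊕ Unit :=
        finSumFinEquiv.symm.trans (Equiv.sumCongr (Equiv.refl _) finOneEquiv)
      have h := E.mnorm_reindex e (Matrix.fromBlocks (Matrix.diagonal fun _ : Fin n => v) 0 0
        (Matrix.of fun _ _ : Unit => v))
      rw [mnorm_fromBlocks, max_eq_right ih] at h
      refine le_of_eq (Eq.trans ?_ h)
      congr 1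
      have h2 : Matrix.fromBlocks (Matrix.diagonal fun _ : Fin n => v) 0 0
          (Matrix.of fun _ _ : Unit => v) = Matrix.diagonal fun _ : Fin n ⊕ Unit => v := by
        ext i j
        rcases i with i | i <;> rcases j with j | j <;> simp [Matrix.diagonal_apply]
      rw [h2]
      ext i j
      simp [Matrix.diagonal_apply]
  have h := E.mnorm_reindex (Fintype.equivFin ι) (Matrix.diagonal fun _ => v)
  have h2 : (Matrix.diagonal fun _ : Fin (Fintype.card ι) => v).submatrix
      (Fintype.equivFin ι) (Fintype.equivFin ι) = Matrix.diagonal fun _ : ι => v := by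
    ext i j
    simp [Matrix.diagonal_apply]
  rw [h2] at h
  rw [h]
  exact key _

/-- The matrix `a ⊗ v` has norm at most `‖a‖ ‖v‖`. -/
theorem mnorm_smul_const_le [DecidableEq ι] (a : Matrix ι ι ℂ) (v : V) :
    E.mnorm (Matrix.of fun i j => a i j • v) ≤ ‖a‖ * E.mnorm (Matrix.of fun _ _ : Unit => v) := by
  have h := E.mnorm_sandwich_le a (Matrix.diagonal fun _ => v) 1
  have h' : sandwich a (Matrix.diagonal fun _ => v) 1 = Matrix.of fun i j => a i j • v := by
    ext i j
    simp [sandwich, Matrix.diagonal_apply, Matrix.one_apply]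
  rw [h'] at h
  have h1 : ‖(1 : Matrix ι ι ℂ)‖ ≤ 1 := norm_le_one_of_conjTranspose_mul_self (by simp)
  have h2 := E.mnorm_diagonal_le (ι := ι) v
  have h3 := E.mnorm_nonneg (Matrix.diagonal fun _ : ι => v)
  have h4 := E.mnorm_nonneg (Matrix.of fun _ _ : Unit => v)
  calc _ ≤ _ := h
    _ ≤ ‖a‖ * E.mnorm (Matrix.of fun _ _ : Unit => v) * 1 := by gcongr
    _ = _ := mul_one _

theorem mnorm_functional_le [DecidableEq ι] (f : V →ₗ[ℂ] ℂ) {C : ℝ} (hC : 0 ≤ C)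
    (hf : ∀ v, ‖f v‖ ≤ C * E.mnorm (Matrix.of fun _ _ : Unit => v)) (x : Matrix ι ι V) :
    ‖x.map f‖ ≤ C * E.mnorm x := by
  refine norm_le_of_forall_sesq (mul_nonneg hC (E.mnorm_nonneg x)) fun ξ η => ?_
  have h := E.mnorm_sandwich_le' (Matrix.of fun i (_ : Unit) => ξ i).conjTranspose x
    (Matrix.of fun i (_ : Unit) => η i)
  rw [Matrix.l2_opNorm_conjTranspose] at h
  have h' := hf (∑ i, ∑ j, (star (ξ i) * η j) • x i j)
  have h0 : f (∑ i, ∑ j, (star (ξ i) * η j) • x i j) =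
      ∑ i, ∑ j, star (ξ i) * (x.map f) i j * η j := by
    simp only [map_sum, map_smul, smul_eq_mul, Matrix.map_apply]
    refine Finset.sum_congr rfl fun i _ => Finset.sum_congr rfl fun j _ => by ring
  rw [h0] at h'
  refine h'.trans ?_
  have h1 := norm_col_le ξ
  have h2 := norm_col_le η
  have h3 := E.mnorm_nonneg x
  calc _ ≤ C * (‖(Matrix.of fun i (_ : Unit) => ξ i : Matrix ι Unit ℂ)‖ * E.mnorm x *
        ‖(Matrix.of fun i (_ : Unit) => η i : Matrix ι Unit ℂ)‖) := by
        refine mul_le_mul_of_nonneg_left (le_trans (le_of_eq ?_) h) hC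
        rfl
    _ ≤ C * (‖ξ‖ * E.mnorm x * ‖η‖) := by gcongr
    _ = _ := by ring

end

/-- Linear functionals on a finite-dimensional operator space are bounded. -/
theorem exists_functional_bound [FiniteDimensional ℂ V] (f : V →ₗ[ℂ] ℂ) :
    ∃ C : ℝ, 0 ≤ C ∧ ∀ v, ‖f v‖ ≤ C * E.mnorm (Matrix.of fun _ _ : Unit => v) := by
  let p : AddGroupNorm V :=
    { toFun := fun v => E.mnorm (Matrix.of fun _ _ : Unit => v)
      map_zero' := E.mnorm_zero
      add_le' := fun v w => E.mnorm_add_le _ _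
      neg' := fun v => by
        have := E.mnorm_smul (-1) (Matrix.of fun _ _ : Unit => v)
        simp only [norm_neg, norm_one, one_mul] at this
        rw [← this]
        congr 1
        ext i j
        simp
      eq_zero_of_map_eq_zero' := fun v hv =>
        congrFun (congrFun (E.eq_zero_of_mnorm hv) ()) () }
  let _ : NormedAddCommGroup V := p.toNormedAddCommGroup
  let _ : NormedSpace ℂ V :=
    { norm_smul_le := fun c v => le_of_eq (E.mnorm_smul c (Matrix.of fun _ _ : Unit => v)) }
  exact ⟨‖LinearMap.toContinuousLinearMap f‖, norm_nonneg _,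
    (LinearMap.toContinuousLinearMap f).le_opNorm⟩

/-- Every linear map from a finite-dimensional operator space is completely bounded. -/
theorem exists_cb_bound [FiniteDimensional ℂ V] {W : Type*} [AddCommGroup W] [Module ℂ W]
    (F : OperatorSpaceStructure W) (f : V →ₗ[ℂ] W) :
    ∃ C : ℝ, 0 ≤ C ∧ ∀ (n : ℕ) (x : Matrix (Fin n) (Fin n) V),
      F.nrm n (x.map f) ≤ C * E.nrm n x := by
  let b := Module.finBasis ℂ V
  choose C hC0 hC using fun i => E.exists_functional_bound (b.coord i)
  refine ⟨∑ i, C i * F.mnorm (Matrix.of fun _ _ : Unit => f (b i)), Finset.sum_nonneg fun i _ =>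
    mul_nonneg (hC0 i) (F.mnorm_nonneg _), fun n x => ?_⟩
  rw [← mnorm_fin, ← mnorm_fin]
  have hx : x.map f = ∑ t, Matrix.of fun i j => (x.map (b.coord t)) i j • f (b t) := by
    ext i j
    rw [Matrix.sum_apply]
    simp only [Matrix.map_apply, Module.Basis.coord_apply, Matrix.of_apply, ← map_smul]
    rw [← map_sum, b.sum_repr]
  rw [hx]
  refine (F.mnorm_sum_le _ _).trans ?_
  rw [Finset.sum_mul]
  refine Finset.sum_le_sum fun t _ => (F.mnorm_smul_const_le _ _).trans ?_
  have h := E.mnorm_functional_le (b.coord t) (hC0 t) (hC t) x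
  have h' := F.mnorm_nonneg (Matrix.of fun _ _ : Unit => f (b t))
  calc _ ≤ C t * E.mnorm x * F.mnorm (Matrix.of fun _ _ : Unit => f (b t)) := by gcongr
    _ = _ := by ring

end OperatorSpaceStructure

/-! ### Constructions of operator space structures -/

namespace OperatorSpaceStructure

variable {V W : Type*} [AddCommGroup V] [Module ℂ V] [AddCommGroup W] [Module ℂ W]

theorem map_sandwich {ι κ : Type*} [Fintype ι] (f : V →ₗ[ℂ] W) (α : Matrix κ ι ℂ)
    (x : Matrix ι ι V) (β : Matrix ι κ ℂ) : (sandwich α x β).map f = sandwich α (x.map f) β := by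
  ext i j
  simp [sandwich, map_sum]

theorem map_directSum {m n : ℕ} (f : V →ₗ[ℂ] W) (x : Matrix (Fin m) (Fin m) V)
    (y : Matrix (Fin n) (Fin n) V) : (directSum x y).map f = directSum (x.map f) (y.map f) := by
  have h : (Matrix.fromBlocks x 0 0 y).map f = Matrix.fromBlocks (x.map f) 0 0 (y.map f) := by
    rw [Matrix.fromBlocks_map, Matrix.map_zero _ (map_zero f), Matrix.map_zero _ (map_zero f)]
  unfold directSum
  rw [← h]
  rfl

/-- The operator space structure inherited along a linear isomorphism. -/
noncomputable def comap (e : V ≃ₗ[ℂ] W) (E : OperatorSpaceStructure W) : OperatorSpaceStructure V where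
  nrm n := (E.nrm n).comp (e.toLinearMap.mapMatrix : Matrix (Fin n) (Fin n) V →ₗ[ℂ] _)
  definite n x hx := by
    have h := E.definite n _ hx
    ext i j
    simpa using congrFun (congrFun h i) j
  nrm_directSum m n x y := by
    simp only [Seminorm.comp_apply, LinearMap.mapMatrix_apply, map_directSum, nrm_directSum]
  nrm_sandwich_le n α x β := by
    simp only [Seminorm.comp_apply, LinearMap.mapMatrix_apply, map_sandwich]
    exact E.nrm_sandwich_le _ _ _ _

/-- The operator space structure of `ℂ`: the operator norms on the matrices `𝕄ₙ(ℂ)`. -/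
noncomputable def complex : OperatorSpaceStructure ℂ where
  nrm n := normSeminorm ℂ (Matrix (Fin n) (Fin n) ℂ)
  definite n x hx := norm_eq_zero.1 hx
  nrm_directSum m n x y := by
    change ‖directSum x y‖ = max ‖x‖ ‖y‖
    rw [← norm_fromBlocks_diag]
    refine le_antisymm (norm_submatrix_equiv_le _ _) ?_
    have h := norm_submatrix_equiv_le finSumFinEquiv (directSum x y)
    simpa [directSum, Matrix.submatrix_submatrix] using h
  nrm_sandwich_le n α x β := by
    have h : sandwich α x β = α * x * β := by
      ext i j
      simp only [sandwich, Matrix.mul_apply, Finset.sum_mul, smul_eq_mul]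
      rw [Finset.sum_comm]
      exact Finset.sum_congr rfl fun k _ => Finset.sum_congr rfl fun l _ => by ring
    rw [h]
    change ‖α * x * β‖ ≤ ‖α‖ * ‖x‖ * ‖β‖
    refine (norm_mul_le _ _).trans ?_
    gcongr
    exact norm_mul_le _ _

/-- The `ℓ^∞`-direct sum: `𝕄ₙ(V × W)` carries the maximum of the norms of `𝕄ₙ(V)` and
`𝕄ₙ(W)`. -/
noncomputable def linfty (E : OperatorSpaceStructure V) (F : OperatorSpaceStructure W) :
    OperatorSpaceStructure (V × W) where
  nrm n := (E.nrm n).comp ((LinearMap.fst ℂ V W).mapMatrix : Matrix (Fin n) (Fin n) _ →ₗ[ℂ] _) ⊔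
    (F.nrm n).comp ((LinearMap.snd ℂ V W).mapMatrix : Matrix (Fin n) (Fin n) _ →ₗ[ℂ] _)
  definite n x hx := by
    simp only [Seminorm.sup_apply, Seminorm.comp_apply] at hx
    have h1 := E.definite n _ (le_antisymm (hx ▸ le_max_left _ _) (apply_nonneg _ _))
    have h2 := F.definite n _ (le_antisymm (hx ▸ le_max_right _ _) (apply_nonneg _ _))
    ext i j
    · simpa using congrFun (congrFun h1 i) j
    · simpa using congrFun (congrFun h2 i) j
  nrm_directSum m n x y := by
    simp only [Seminorm.sup_apply, Seminorm.comp_apply, LinearMap.mapMatrix_apply,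
      map_directSum, nrm_directSum]
    exact max_max_max_comm _ _ _ _
  nrm_sandwich_le n α x β := by
    simp only [Seminorm.sup_apply, Seminorm.comp_apply, LinearMap.mapMatrix_apply, map_sandwich]
    refine max_le ((E.nrm_sandwich_le _ _ _ _).trans ?_) ((F.nrm_sandwich_le _ _ _ _).trans ?_)
    · gcongr
      exact le_max_left _ _
    · gcongr
      exact le_max_right _ _

/-- A matrix of matrices, as a matrix indexed by pairs. -/
def blockMatrix {m n : ℕ} (x : Matrix (Fin m) (Fin m) (Matrix (Fin n) (Fin n) V)) :
    Matrix (Fin m × Fin n) (Fin m × Fin n) V :=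
  Matrix.of fun p q => x p.1 q.1 p.2 q.2

@[simp]
theorem blockMatrix_apply {V : Type*} {m n : ℕ}
    (x : Matrix (Fin m) (Fin m) (Matrix (Fin n) (Fin n) V))
    (p q : Fin m × Fin n) : blockMatrix x p q = x p.1 q.1 p.2 q.2 := rfl

/-- The linear isomorphism `𝕄ₘ(𝕄ₙ(V)) ≅ 𝕄ₘₙ(V)`. -/
def flatten (V : Type*) [AddCommGroup V] [Module ℂ V] (m n : ℕ) :
    Matrix (Fin m) (Fin m) (Matrix (Fin n) (Fin n) V) →ₗ[ℂ]
      Matrix (Fin (m * n)) (Fin (m * n)) V where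
  toFun x := (blockMatrix x).submatrix finProdFinEquiv.symm finProdFinEquiv.symm
  map_add' _ _ := rfl
  map_smul' _ _ := rfl

theorem nrm_flatten (E : OperatorSpaceStructure V) {m n : ℕ}
    (x : Matrix (Fin m) (Fin m) (Matrix (Fin n) (Fin n) V)) :
    E.nrm (m * n) (flatten V m n x) = E.mnorm (blockMatrix x) :=
  (E.mnorm_eq finProdFinEquiv _).symm

/-- The operator space structure of `Mₙ(V)`, given by `𝕄ₘ(𝕄ₙ(V)) ≅ 𝕄ₘₙ(V)`. -/
noncomputable def matrix (E : OperatorSpaceStructure V) (n : ℕ) :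
    OperatorSpaceStructure (Matrix (Fin n) (Fin n) V) where
  nrm m := (E.nrm (m * n)).comp (flatten V m n)
  definite m x hx := by
    rw [Seminorm.comp_apply, nrm_flatten] at hx
    have h := E.eq_zero_of_mnorm hx
    ext i j k l
    exact congrFun (congrFun h (i, k)) (j, l)
  nrm_directSum m m' x y := by
    simp only [Seminorm.comp_apply, nrm_flatten]
    rw [← mnorm_fromBlocks, ← E.mnorm_reindex
      ((finSumFinEquiv.symm.prodCongr (Equiv.refl _)).trans (Equiv.sumProdDistrib _ _ _))]
    congr 1
    ext ⟨i, k⟩ ⟨j, l⟩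
    rcases hi : finSumFinEquiv.symm i with a | a <;>
      rcases hj : finSumFinEquiv.symm j with b | b <;>
      simp [directSum, hi, hj]
  nrm_sandwich_le m α x β := by
    simp only [Seminorm.comp_apply, nrm_flatten]
    have h := E.mnorm_sandwich_le (α ⊗ₖ (1 : Matrix (Fin n) (Fin n) ℂ)) (blockMatrix x)
      (β ⊗ₖ (1 : Matrix (Fin n) (Fin n) ℂ))
    have h' : sandwich (α ⊗ₖ (1 : Matrix (Fin n) (Fin n) ℂ)) (blockMatrix x)
      (β ⊗ₖ (1 : Matrix (Fin n) (Fin n) ℂ)) = blockMatrix (sandwich α x β) := by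
      ext ⟨i, k⟩ ⟨j, l⟩
      simp [sandwich, Fintype.sum_prod_type, Matrix.one_apply]
      simp only [Matrix.sum_apply, Matrix.smul_apply]
    rw [h'] at h
    refine h.trans ?_
    have h1 := norm_kronecker_one_le (κ := Fin n) α
    have h2 := norm_kronecker_one_le (κ := Fin n) β
    have h3 := E.mnorm_nonneg (blockMatrix x)
    gcongr

theorem nrm_matrix (E : OperatorSpaceStructure V) {m n : ℕ}
    (x : Matrix (Fin m) (Fin m) (Matrix (Fin n) (Fin n) V)) :
    (E.matrix n).nrm m x = E.mnorm (blockMatrix x) :=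
  nrm_flatten E x

/-! ### Completely bounded maps -/

variable (E : OperatorSpaceStructure V) (F : OperatorSpaceStructure W)

/-- The `cb`-norm of a linear map `φ`, i.e. the supremum over `n` of the operator norms of the
amplifications `φₙ`, where `φₙ x = x.map φ` is the entrywise application of `φ`. -/
noncomputable def cbNorm (f : V →ₗ[ℂ] W) : ℝ :=
  sSup {r : ℝ | ∃ (n : ℕ) (x : Matrix (Fin n) (Fin n) V), E.nrm n x ≤ 1 ∧ r = F.nrm n (x.map f)}

theorem cbNorm_nonneg (f : V →ₗ[ℂ] W) : 0 ≤ cbNorm E F f := by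
  refine Real.sSup_nonneg ?_
  rintro r ⟨n, x, -, rfl⟩
  exact apply_nonneg _ _

theorem cbNorm_le {f : V →ₗ[ℂ] W} {C : ℝ} (hC : 0 ≤ C)
    (h : ∀ (n : ℕ) (x : Matrix (Fin n) (Fin n) V), F.nrm n (x.map f) ≤ C * E.nrm n x) :
    cbNorm E F f ≤ C := by
  refine Real.sSup_le ?_ hC
  rintro r ⟨n, x, hx, rfl⟩
  exact (h n x).trans (mul_le_of_le_one_right hC hx)

theorem nrm_map_le_cbNorm [FiniteDimensional ℂ V] (f : V →ₗ[ℂ] W) (n : ℕ)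
    (x : Matrix (Fin n) (Fin n) V) : F.nrm n (x.map f) ≤ cbNorm E F f * E.nrm n x := by
  obtain ⟨C, hC0, hC⟩ := E.exists_cb_bound F f
  have hb : BddAbove {r : ℝ | ∃ (n : ℕ) (x : Matrix (Fin n) (Fin n) V),
      E.nrm n x ≤ 1 ∧ r = F.nrm n (x.map f)} := by
    refine ⟨C, ?_⟩
    rintro r ⟨n, x, hx, rfl⟩
    exact (hC n x).trans (mul_le_of_le_one_right hC0 hx)
  rcases (apply_nonneg (E.nrm n) x).eq_or_lt with h0 | h0
  · have hx := E.definite n x h0.symm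
    subst hx
    simp [Matrix.map_zero]
  · set t := E.nrm n x with ht
    have h1 : E.nrm n (((t⁻¹ : ℝ) : ℂ) • x) ≤ 1 := by
      rw [map_smul_eq_mul, Complex.norm_real, Real.norm_of_nonneg (inv_nonneg.2 h0.le), ← ht,
        inv_mul_cancel₀ h0.ne']
    have h2 := le_csSup hb ⟨n, _, h1, rfl⟩
    have h3 : (((t⁻¹ : ℝ) : ℂ) • x).map f = ((t⁻¹ : ℝ) : ℂ) • x.map f := by
      ext i j
      simp
    rw [h3, map_smul_eq_mul, Complex.norm_real, Real.norm_of_nonneg (inv_nonneg.2 h0.le)] at h2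
    change _ ≤ cbNorm E F f at h2
    rwa [inv_mul_le_iff₀ h0, mul_comm] at h2

/-- The `cb`-norm, as a seminorm on the space of linear maps. -/
noncomputable def cbSeminorm [FiniteDimensional ℂ V] : Seminorm ℂ (V →ₗ[ℂ] W) :=
  Seminorm.ofSMulLE (cbNorm E F)
    (le_antisymm (cbNorm_le E F le_rfl fun n x => by
      have : x.map (0 : V →ₗ[ℂ] W) = 0 := rfl
      simp [this]) (cbNorm_nonneg E F 0))
    (fun f g => cbNorm_le E F (add_nonneg (cbNorm_nonneg E F f) (cbNorm_nonneg E F g))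
      fun n x => by
        have : x.map (f + g) = x.map f + x.map g := rfl
        rw [this, add_mul]
        exact (map_add_le_add _ _ _).trans
          (add_le_add (nrm_map_le_cbNorm E F f n x) (nrm_map_le_cbNorm E F g n x)))
    (fun c f => cbNorm_le E F (mul_nonneg (norm_nonneg c) (cbNorm_nonneg E F f)) fun n x => by
        have : x.map (c • f) = c • x.map f := rfl
        rw [this, map_smul_eq_mul, mul_assoc]
        exact mul_le_mul_of_nonneg_left (nrm_map_le_cbNorm E F f n x) (norm_nonneg c))

/-- The linear isomorphism `𝕄ₙ(L(V, W)) ≅ L(V, 𝕄ₙ(W))`. -/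
def toMatrixMap (V W : Type*) [AddCommGroup V] [Module ℂ V] [AddCommGroup W] [Module ℂ W] (n : ℕ) :
    Matrix (Fin n) (Fin n) (V →ₗ[ℂ] W) →ₗ[ℂ] V →ₗ[ℂ] Matrix (Fin n) (Fin n) W where
  toFun φ :=
    { toFun := fun v => Matrix.of fun i j => φ i j v
      map_add' := fun v w => by ext i j; simp
      map_smul' := fun c v => by ext i j; simp }
  map_add' _ _ := rfl
  map_smul' _ _ := rfl

@[simp]
theorem toMatrixMap_apply {n : ℕ} (φ : Matrix (Fin n) (Fin n) (V →ₗ[ℂ] W)) (v : V) (i j : Fin n) :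
    toMatrixMap V W n φ v i j = φ i j v := rfl

/-- The operator space structure of `CB(V, W)`, given by the isomorphism
`𝕄ₙ(CB(V, W)) ≅ CB(V, Mₙ(W))` and the `cb`-norm of the latter space. Since `V` is
finite-dimensional, `CB(V, W)` consists of all linear maps. -/
noncomputable def cb [FiniteDimensional ℂ V] : OperatorSpaceStructure (V →ₗ[ℂ] W) where
  nrm n := (cbSeminorm E (F.matrix n)).comp (toMatrixMap V W n)
  definite n φ hφ := by
    have hφ' : cbNorm E (F.matrix n) (toMatrixMap V W n φ) = 0 := hφ
    ext i j v
    have h := nrm_map_le_cbNorm E (F.matrix n) (toMatrixMap V W n φ) 1 (Matrix.of fun _ _ => v)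
    rw [hφ', zero_mul] at h
    have h1 := (F.matrix n).definite _ _ (le_antisymm h (apply_nonneg _ _))
    exact congrFun (congrFun (congrFun (congrFun h1 0) 0) i) j
  nrm_directSum p q φ ψ := by
    change cbNorm E (F.matrix (p + q)) (toMatrixMap V W _ (directSum φ ψ)) =
      max (cbNorm E (F.matrix p) (toMatrixMap V W p φ)) (cbNorm E (F.matrix q) (toMatrixMap V W q ψ))
    have key : ∀ (n : ℕ) (x : Matrix (Fin n) (Fin n) V),
        (F.matrix (p + q)).nrm n (x.map (toMatrixMap V W _ (directSum φ ψ))) =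
        max ((F.matrix p).nrm n (x.map (toMatrixMap V W p φ)))
          ((F.matrix q).nrm n (x.map (toMatrixMap V W q ψ))) := by
      intro n x
      simp only [nrm_matrix]
      rw [← mnorm_fromBlocks, ← F.mnorm_reindex
        (((Equiv.refl _).prodCongr finSumFinEquiv.symm).trans (Equiv.prodSumDistrib _ _ _))]
      congr 1
      ext ⟨i, k⟩ ⟨j, l⟩
      rcases hk : finSumFinEquiv.symm k with a | a <;>
        rcases hl : finSumFinEquiv.symm l with b | b <;>
        simp [directSum, hk, hl]
    refine le_antisymm (cbNorm_le _ _ (le_max_of_le_left (cbNorm_nonneg _ _ _)) fun n x => ?_)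
      (max_le (cbNorm_le _ _ (cbNorm_nonneg _ _ _) fun n x => ?_)
        (cbNorm_le _ _ (cbNorm_nonneg _ _ _) fun n x => ?_))
    · rw [key]
      have h0 : 0 ≤ E.nrm n x := apply_nonneg _ _
      refine max_le ((nrm_map_le_cbNorm E (F.matrix p) _ n x).trans ?_)
        ((nrm_map_le_cbNorm E (F.matrix q) _ n x).trans ?_)
      · gcongr
        exact le_max_left _ _
      · gcongr
        exact le_max_right _ _
    · refine le_trans ?_ (nrm_map_le_cbNorm _ _ _ n x)
      rw [key]
      exact le_max_left _ _
    · refine le_trans ?_ (nrm_map_le_cbNorm _ _ _ n x)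
      rw [key]
      exact le_max_right _ _
  nrm_sandwich_le p α φ β := by
    change cbNorm E (F.matrix p) (toMatrixMap V W _ (sandwich α φ β)) ≤
      ‖α‖ * cbNorm E (F.matrix p) (toMatrixMap V W p φ) * ‖β‖
    refine cbNorm_le _ _ (mul_nonneg (mul_nonneg (norm_nonneg _) (cbNorm_nonneg _ _ _))
      (norm_nonneg _)) fun n x => ?_
    have h0 := nrm_map_le_cbNorm E (F.matrix p) (toMatrixMap V W p φ) n x
    simp only [nrm_matrix] at h0 ⊢
    have h := F.mnorm_sandwich_le ((1 : Matrix (Fin n) (Fin n) ℂ) ⊗ₖ α)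
      (blockMatrix (x.map (toMatrixMap V W p φ))) ((1 : Matrix (Fin n) (Fin n) ℂ) ⊗ₖ β)
    have h' : sandwich ((1 : Matrix (Fin n) (Fin n) ℂ) ⊗ₖ α)
        (blockMatrix (x.map (toMatrixMap V W p φ)))
        ((1 : Matrix (Fin n) (Fin n) ℂ) ⊗ₖ β) =
        blockMatrix (x.map (toMatrixMap V W p (sandwich α φ β))) := by
      ext ⟨i, k⟩ ⟨j, l⟩
      simp [sandwich, Fintype.sum_prod_type, Matrix.one_apply]
    rw [h'] at h
    refine h.trans ?_
    have h1 := norm_one_kronecker_le (κ := Fin n) α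
    have h2 := norm_one_kronecker_le (κ := Fin n) β
    have h3 := F.mnorm_nonneg (blockMatrix (x.map (toMatrixMap V W p φ)))
    refine le_trans (b := ‖α‖ * (F.mnorm (blockMatrix (x.map (toMatrixMap V W p φ)))) *
      ‖β‖) (by gcongr) (le_trans (b := ‖α‖ * (cbNorm E (F.matrix p) (toMatrixMap V W p φ) *
        E.nrm n x) * ‖β‖) ?_ (le_of_eq (by ring)))
    gcongr

end OperatorSpaceStructure

/-! ### Star-autonomous categories and models of MALL -/

open CategoryTheory MonoidalCategory Limits

section StarAutonomous

universe v u

/-- Internal homs with prescribed objects `H A B`: evaluation morphisms `A ⊗ H A B ⟶ B` with the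
universal property of currying. -/
structure InternalHom (C : Type u) [Category.{v} C] [MonoidalCategory C] (H : C → C → C) where
  /-- evaluation -/
  ev : ∀ A B : C, A ⊗ H A B ⟶ B
  existsUnique_curry : ∀ {A B Z : C} (f : A ⊗ Z ⟶ B), ∃! g : Z ⟶ H A B, A ◁ g ≫ ev A B = f

namespace InternalHom

variable {C : Type u} [Category.{v} C] [MonoidalCategory C] {H : C → C → C}

/-- The currying bijection. -/
noncomputable def curryEquiv (h : InternalHom C H) (A Z B : C) : (A ⊗ Z ⟶ B) ≃ (Z ⟶ H A B) where
  toFun f := (h.existsUnique_curry f).choose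
  invFun g := A ◁ g ≫ h.ev A B
  left_inv f := (h.existsUnique_curry f).choose_spec.1
  right_inv g := ((h.existsUnique_curry (A ◁ g ≫ h.ev A B)).choose_spec.2 g rfl).symm

/-- The closed structure in which the internal hom of `A` and `B` is `H A B` and the evaluation
morphisms are the given ones. -/
@[reducible]
noncomputable def monoidalClosed (h : InternalHom C H) : MonoidalClosed C where
  closed A :=
    { rightAdj := Adjunction.rightAdjointOfEquiv (F := tensorLeft A) (G_obj := H A)
        (fun Z B => h.curryEquiv A Z B) (fun Z' Z B f g => by
          apply (h.curryEquiv A Z' B).symm.injective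
          rw [Equiv.symm_apply_apply]
          have h1 : A ◁ (h.curryEquiv A Z B g) ≫ h.ev A B = g :=
            (h.curryEquiv A Z B).symm_apply_apply g
          change A ◁ f ≫ g = A ◁ (f ≫ h.curryEquiv A Z B g) ≫ h.ev A B
          rw [MonoidalCategory.whiskerLeft_comp, Category.assoc, h1])
      adj := Adjunction.adjunctionOfEquivRight _ _ }

end InternalHom

variable {C : Type u} [Category.{v} C] [MonoidalCategory C] [SymmetricCategory C]
  [MonoidalClosed C]

/-- The canonical morphism `A ⟶ (A ⊸ D) ⊸ D`, obtained by currying the evaluation. -/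
def toBidual (D A : C) : A ⟶ (ihom ((ihom A).obj D)).obj D :=
  MonoidalClosed.curry ((β_ ((ihom A).obj D) A).hom ≫ (ihom.ev A).app D)

/-- The functor `(A, B) ↦ A ⅋ B = (A ⊸ D) ⊸ B` on objects. -/
def par (D A B : C) : C := (ihom ((ihom A).obj D)).obj B

/-- The functor `(A, B) ↦ A ⅋ B = (A ⊸ D) ⊸ B` on morphisms. -/
def parMap (D : C) {A A' B B' : C} (f : A ⟶ A') (g : B ⟶ B') : par D A B ⟶ par D A' B' :=
  (MonoidalClosed.pre ((MonoidalClosed.pre f).app D)).app B ≫ (ihom ((ihom A').obj D)).map g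

/-- A symmetric monoidal closed category is `*`-autonomous with dualizing object `D` if all
canonical morphisms `A ⟶ (A ⊸ D) ⊸ D` are isomorphisms. -/
structure IsStarAutonomous (D : C) : Prop where
  isIso_toBidual : ∀ A : C, IsIso (toBidual D A)

/-- A (categorical) model of multiplicative additive linear logic: a `*`-autonomous category with
finite products and finite coproducts. -/
structure IsMALLModel (D : C) : Prop extends IsStarAutonomous D where
  hasFiniteProducts : HasFiniteProducts C
  hasFiniteCoproducts : HasFiniteCoproducts C

end StarAutonomous

/-! ### The category of finite-dimensional operator spaces -/

/-- A finite-dimensional operator space. -/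
structure FdOS where
  /-- the underlying vector space -/
  carrier : Type
  [addCommGroup : AddCommGroup carrier]
  [module : Module ℂ carrier]
  [finiteDimensional : FiniteDimensional ℂ carrier]
  /-- the operator space structure -/
  oss : OperatorSpaceStructure carrier

namespace FdOS

instance : CoeSort FdOS Type := ⟨carrier⟩

attribute [instance] addCommGroup module finiteDimensional

/-- A linear map is a complete contraction if all its amplifications are contractions. -/
def IsCC {X Y : FdOS} (f : X →ₗ[ℂ] Y) : Prop :=
  ∀ (n : ℕ) (x : Matrix (Fin n) (Fin n) X), Y.oss.nrm n (x.map f) ≤ X.oss.nrm n x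

/-- The morphisms between finite-dimensional operator spaces: complete contractions. -/
@[ext]
structure Hom (X Y : FdOS) where
  /-- the underlying linear map -/
  lin : X →ₗ[ℂ] Y
  isCC : IsCC lin

instance : Category FdOS where
  Hom := Hom
  id X := ⟨LinearMap.id, fun _ _ => le_rfl⟩
  comp f g := ⟨g.lin ∘ₗ f.lin, fun n x => (g.isCC n (x.map f.lin)).trans (f.isCC n x)⟩

@[ext]
theorem hom_ext {X Y : FdOS} {f g : X ⟶ Y} (h : f.lin = g.lin) : f = g := Hom.ext h

@[simp] theorem id_lin (X : FdOS) : Hom.lin (𝟙 X) = LinearMap.id := rfl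

@[simp] theorem comp_lin {X Y Z : FdOS} (f : X ⟶ Y) (g : Y ⟶ Z) :
    (f ≫ g).lin = g.lin ∘ₗ f.lin := rfl

/-- A linear isomorphism which is completely contractive in both directions is an isomorphism. -/
def isoMk {X Y : FdOS} (e : X ≃ₗ[ℂ] Y) (h : IsCC e.toLinearMap) (h' : IsCC e.symm.toLinearMap) :
    X ≅ Y where
  hom := ⟨e.toLinearMap, h⟩
  inv := ⟨e.symm.toLinearMap, h'⟩
  hom_inv_id := by ext x; simp
  inv_hom_id := by ext x; simp

/-- The operator space `ℂ`. -/
noncomputable def complex : FdOS := ⟨ℂ, OperatorSpaceStructure.complex⟩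

/-- The zero-dimensional operator space. -/
noncomputable def zero : FdOS where
  carrier := PUnit
  oss :=
    { nrm := fun _ => 0
      definite := fun _ _ _ => Subsingleton.elim _ _
      nrm_directSum := fun _ _ _ _ => by simp
      nrm_sandwich_le := fun _ _ _ _ => by simp }

/-- The `ℓ^∞`-direct sum `X ⊕^∞ Y`. -/
noncomputable def linftySum (X Y : FdOS) : FdOS := ⟨X × Y, X.oss.linfty Y.oss⟩

/-- The operator space `CB(X, Y)` of (completely bounded) linear maps. -/
noncomputable def CB (X Y : FdOS) : FdOS := ⟨X →ₗ[ℂ] Y, X.oss.cb Y.oss⟩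

/-- The dual operator space `X* = CB(X, ℂ)`. -/
noncomputable def dual (X : FdOS) : FdOS := CB X complex

/-- The linear isomorphism `X × Y ≅ (X* × Y*)*` sending `(x, y)` to
`(f, g) ↦ f x + g y`. -/
noncomputable def loneEquiv (X Y : FdOS) : (X × Y) ≃ₗ[ℂ] (((X →ₗ[ℂ] ℂ) × (Y →ₗ[ℂ] ℂ)) →ₗ[ℂ] ℂ) :=
  ((Module.evalEquiv ℂ X).prodCongr (Module.evalEquiv ℂ Y)).trans
    (Module.dualProdDualEquivDual ℂ (Module.Dual ℂ X) (Module.Dual ℂ Y))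

theorem loneEquiv_apply (X Y : FdOS) (x : X) (y : Y) (f : X →ₗ[ℂ] ℂ) (g : Y →ₗ[ℂ] ℂ) :
    loneEquiv X Y (x, y) (f, g) = f x + g y := rfl

/-- The `ℓ^1`-direct sum `X ⊕^1 Y`, with the operator space structure inherited from
`(X* ⊕^∞ Y*)*`. -/
noncomputable def loneSum (X Y : FdOS) : FdOS :=
  ⟨X × Y, (dual (linftySum (dual X) (dual Y))).oss.comap (loneEquiv X Y)⟩

/-- The linear isomorphism `X ⊗ Y ≅ CB(Y*, X)` sending `x ⊗ y` to `f ↦ f(y) x`. -/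
noncomputable def injEquiv (X Y : FdOS) : (X ⊗[ℂ] Y) ≃ₗ[ℂ] ((Y →ₗ[ℂ] ℂ) →ₗ[ℂ] X) :=
  ((TensorProduct.comm ℂ X Y).trans
    (TensorProduct.congr (Module.evalEquiv ℂ Y) (LinearEquiv.refl ℂ X))).trans
      (dualTensorHomEquiv ℂ (Module.Dual ℂ Y) X)

theorem injEquiv_apply (X Y : FdOS) (x : X) (y : Y) (f : Y →ₗ[ℂ] ℂ) :
    injEquiv X Y (x ⊗ₜ y) f = f y • x := by
  rfl

/-- The operator space structure of the completely injective tensor product, inherited from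
`CB(Y*, X)`. -/
noncomputable def injOSS (X Y : FdOS) : OperatorSpaceStructure (X ⊗[ℂ] Y) :=
  (CB (dual Y) X).oss.comap (injEquiv X Y)

/-- The completely injective tensor product. -/
noncomputable def injTensor (X Y : FdOS) : FdOS := ⟨X ⊗[ℂ] Y, injOSS X Y⟩

/-- The linear isomorphism `X ⊗ Y ≅ (X* ⊗ Y*)*` sending `x ⊗ y` to
`f ⊗ g ↦ f(x) g(y)`. -/
noncomputable def projEquiv (X Y : FdOS) :
    (X ⊗[ℂ] Y) ≃ₗ[ℂ] (((X →ₗ[ℂ] ℂ) ⊗[ℂ] (Y →ₗ[ℂ] ℂ)) →ₗ[ℂ] ℂ) :=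
  (TensorProduct.congr (Module.evalEquiv ℂ X) (Module.evalEquiv ℂ Y)).trans
    (TensorProduct.dualDistribEquiv ℂ (Module.Dual ℂ X) (Module.Dual ℂ Y))

theorem projEquiv_apply (X Y : FdOS) (x : X) (y : Y) (f : X →ₗ[ℂ] ℂ) (g : Y →ₗ[ℂ] ℂ) :
    projEquiv X Y (x ⊗ₜ y) (f ⊗ₜ g) = f x * g y := by
  rfl

/-- The operator space structure of the completely projective tensor product, inherited from the
dual of the completely injective tensor product of the duals. -/
noncomputable def projOSS (X Y : FdOS) : OperatorSpaceStructure (X ⊗[ℂ] Y) :=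
  (dual (injTensor (dual X) (dual Y))).oss.comap (projEquiv X Y)

/-- The linear evaluation map `X ⊗ L(X, Y) → Y`, `x ⊗ φ ↦ φ(x)`. -/
noncomputable def evalMap (X Y : FdOS) : X ⊗[ℂ] (X →ₗ[ℂ] Y) →ₗ[ℂ] Y :=
  TensorProduct.lift LinearMap.applyₗ

/-- The linear map `X ⊗ Y → L(X*, Y)`, `x ⊗ y ↦ (f ↦ f(x) y)`. -/
noncomputable def toHomDual (X Y : FdOS) : X ⊗[ℂ] Y →ₗ[ℂ] ((X →ₗ[ℂ] ℂ) →ₗ[ℂ] Y) :=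
  (injEquiv Y X).toLinearMap ∘ₗ (TensorProduct.comm ℂ X Y).toLinearMap

/-! ### Symmetric monoidal structures given by tensor products -/

/-- The algebraic tensor product with a given operator space structure. -/
def tensorOf (ν : ∀ X Y : FdOS, OperatorSpaceStructure (X ⊗[ℂ] Y)) (X Y : FdOS) : FdOS :=
  ⟨X ⊗[ℂ] Y, ν X Y⟩

/-- The operator space structures `ν X Y` on the algebraic tensor products `X ⊗ Y` make the
category of finite-dimensional operator spaces symmetric monoidal, with unit `ℂ` and with the usual
action on morphisms, associators, unitors and symmetries of the tensor product of vector spaces: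
all these maps and their inverses are complete contractions. -/
structure IsSymmetricMonoidal (ν : ∀ X Y : FdOS, OperatorSpaceStructure (X ⊗[ℂ] Y)) : Prop where
  map_isCC : ∀ {X X' Y Y' : FdOS} (f : X ⟶ X') (g : Y ⟶ Y'),
    IsCC (X := tensorOf ν X Y) (Y := tensorOf ν X' Y') (TensorProduct.map f.lin g.lin)
  assoc_isCC : ∀ X Y Z : FdOS,
    IsCC (X := tensorOf ν (tensorOf ν X Y) Z) (Y := tensorOf ν X (tensorOf ν Y Z))
      (TensorProduct.assoc ℂ X Y Z).toLinearMap
  assoc_symm_isCC : ∀ X Y Z : FdOS,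
    IsCC (X := tensorOf ν X (tensorOf ν Y Z)) (Y := tensorOf ν (tensorOf ν X Y) Z)
      (TensorProduct.assoc ℂ X Y Z).symm.toLinearMap
  lid_isCC : ∀ X : FdOS,
    IsCC (X := tensorOf ν complex X) (Y := X) (TensorProduct.lid ℂ X).toLinearMap
  lid_symm_isCC : ∀ X : FdOS,
    IsCC (X := X) (Y := tensorOf ν complex X) (TensorProduct.lid ℂ X).symm.toLinearMap
  rid_isCC : ∀ X : FdOS,
    IsCC (X := tensorOf ν X complex) (Y := X) (TensorProduct.rid ℂ X).toLinearMap
  rid_symm_isCC : ∀ X : FdOS,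
    IsCC (X := X) (Y := tensorOf ν X complex) (TensorProduct.rid ℂ X).symm.toLinearMap
  comm_isCC : ∀ X Y : FdOS,
    IsCC (X := tensorOf ν X Y) (Y := tensorOf ν Y X) (TensorProduct.comm ℂ X Y).toLinearMap

namespace IsSymmetricMonoidal

variable {ν : ∀ X Y : FdOS, OperatorSpaceStructure (X ⊗[ℂ] Y)}

/-- The tensor product of two complete contractions. -/
noncomputable def tensorMap (h : IsSymmetricMonoidal ν) {X X' Y Y' : FdOS} (f : X ⟶ X') (g : Y ⟶ Y') :
    tensorOf ν X Y ⟶ tensorOf ν X' Y' := ⟨TensorProduct.map f.lin g.lin, h.map_isCC f g⟩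

/-- The monoidal structure. -/
@[reducible]
noncomputable def monoidalCategory (h : IsSymmetricMonoidal ν) : MonoidalCategory FdOS :=
  letI : MonoidalCategoryStruct FdOS :=
    { tensorObj := tensorOf ν
      tensorUnit := complex
      tensorHom := fun f g => h.tensorMap f g
      whiskerLeft := fun X _ _ f => h.tensorMap (𝟙 X) f
      whiskerRight := fun f Y => h.tensorMap f (𝟙 Y)
      associator := fun X Y Z => isoMk (X := tensorOf ν (tensorOf ν X Y) Z)
        (Y := tensorOf ν X (tensorOf ν Y Z)) (TensorProduct.assoc ℂ X Y Z) (h.assoc_isCC X Y Z)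
        (h.assoc_symm_isCC X Y Z)
      leftUnitor := fun X => isoMk (X := tensorOf ν complex X)
        (TensorProduct.lid ℂ X) (h.lid_isCC X) (h.lid_symm_isCC X)
      rightUnitor := fun X => isoMk (X := tensorOf ν X complex)
        (TensorProduct.rid ℂ X) (h.rid_isCC X) (h.rid_symm_isCC X) }
  MonoidalCategory.ofTensorHom (C := FdOS)
    (id_tensorHom_id := fun _ _ => hom_ext TensorProduct.map_id)
    (id_tensorHom := fun _ _ _ _ => rfl)
    (tensorHom_id := fun _ _ => rfl)
    (tensorHom_comp_tensorHom := fun f₁ f₂ g₁ g₂ =>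
      hom_ext (TensorProduct.map_comp g₁.lin g₂.lin f₁.lin f₂.lin).symm)
    (associator_naturality := fun _ _ _ => hom_ext (TensorProduct.ext_threefold fun _ _ _ => rfl))
    (leftUnitor_naturality := fun f => hom_ext (TensorProduct.ext' fun (c : ℂ) x =>
      (map_smul f.lin c x).symm))
    (rightUnitor_naturality := fun f => hom_ext (TensorProduct.ext' fun x (c : ℂ) =>
      (map_smul f.lin c x).symm))
    (pentagon := fun _ _ _ _ => hom_ext (TensorProduct.ext_fourfold fun _ _ _ _ => rfl))
    (triangle := fun _ _ => hom_ext (TensorProduct.ext_threefold fun x (c : ℂ) y =>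
      (TensorProduct.smul_tmul c x y).symm))

/-- The symmetry. -/
@[reducible]
noncomputable def symmetricCategory (h : IsSymmetricMonoidal ν) :
    letI := h.monoidalCategory
    SymmetricCategory FdOS :=
  letI := h.monoidalCategory
  { braiding := fun X Y => isoMk (X := tensorOf ν X Y) (Y := tensorOf ν Y X)
      (TensorProduct.comm ℂ X Y) (h.comm_isCC X Y) (h.comm_isCC Y X)
    braiding_naturality_right := fun _ _ _ _ => hom_ext (TensorProduct.ext' fun _ _ => rfl)
    braiding_naturality_left := fun _ _ => hom_ext (TensorProduct.ext' fun _ _ => rfl)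
    hexagon_forward := fun _ _ _ => hom_ext (TensorProduct.ext_threefold fun _ _ _ => rfl)
    hexagon_reverse := fun _ _ _ => hom_ext (TensorProduct.ext (LinearMap.ext fun _ =>
      TensorProduct.ext' fun _ _ => rfl))
    symmetry := fun _ _ => hom_ext (TensorProduct.ext' fun _ _ => rfl) }

end IsSymmetricMonoidal

end FdOS

/-! ### Sandwich products -/

section Sandwich

variable {V W ι κ τ : Type*} [AddCommGroup V] [Module ℂ V] [AddCommGroup W] [Module ℂ W]
  [Fintype ι] [Fintype κ]

/-! Most of the theorem is formal once matrices are handled through amplifications `amp b x y` of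
bilinear maps. A bilinear map is jointly completely contractive exactly when its curried form V →
CB(W, U) is a complete contraction (`isJointlyCC_iff_isCC`), and the former condition is symmetric
in the two variables because matrix norms are invariant under permutations of the index set.

The analytic core is that a matrix over V is normed by the complete contractions from V to matrix
algebras (`mnorm_le_of_dual`). Take a Hahn–Banach functional F with F(x) = ‖x‖. A second separation
argument, on a cone whose convexity comes from Ruan's axioms, gives functionals p, q on scalar
matrices with 2 Re F(αyβ) ≤ Re p(αα*) + Re q(β*β) for all y in the unit ball
(`exists_dominating_functionals`). After a small perturbation p and q are bounded by Hilbert-Schmidt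
norms weighted with invertible matrices S and T. Dividing F by these weights yields a completely
contractive matrix φ of functionals, and F(x) is recovered as a matrix coefficient of φ(x) at
vectors ξ, η with ‖ξ‖‖η‖ close to one.

It follows that X → X** is completely isometric (`isCC_eval`, `isCC_evalEquiv_symm`) and that
complete contractivity may be tested on transposes (`isCC_of_transpose`).

The injective norm is computed by slicing with functionals of one factor. Testing the slices against
functionals of the other factor makes the expression symmetric, and slicing off the two outer
factors of a triple product gives associativity. The projective norm is dual to the injective one;
reflexivity and transposition show that it linearises jointly completely contractive bilinear maps
(`isCC_proj_iff`). Its coherence maps and the internal hom CB(X, Y) then come from currying,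
reflexivity makes ℂ dualizing, and the par CB(X*, Y) is the defining space of the injective product
up to symmetry. The mapping property of the ℓ¹-sum comes from that of the ℓ^∞-sum of the duals by
transposition. -/

theorem sandwich_sandwich (α : Matrix τ κ ℂ) (γ : Matrix κ ι ℂ) (x : Matrix ι ι V)
    (δ : Matrix ι κ ℂ) (β : Matrix κ τ ℂ) :
    sandwich α (sandwich γ x δ) β = sandwich (α * γ) x (δ * β) := by
  ext i j
  simp only [sandwich, Matrix.mul_apply, Finset.smul_sum, smul_smul, Finset.sum_mul_sum,
    Finset.sum_smul]
  simp_rw [Finset.sum_comm (s := (Finset.univ : Finset κ)) (t := (Finset.univ : Finset ι))]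
  refine Finset.sum_congr rfl fun _ _ => Finset.sum_congr rfl fun _ _ =>
    Finset.sum_congr rfl fun _ _ => Finset.sum_congr rfl fun _ _ => ?_
  congr 1
  ring

theorem sandwich_one [DecidableEq ι] (x : Matrix ι ι V) :
    sandwich (1 : Matrix ι ι ℂ) x 1 = x := by
  ext i j
  simp [sandwich, Matrix.one_apply]

theorem sandwich_zero (α : Matrix τ ι ℂ) (β : Matrix ι τ ℂ) :
    sandwich α (0 : Matrix ι ι V) β = 0 := by
  ext i j
  simp [sandwich]

/-- The product `α x β`, as a linear map in `x`. -/
def sandwichₗ (α : Matrix τ ι ℂ) (β : Matrix ι τ ℂ) : Matrix ι ι V →ₗ[ℂ] Matrix τ τ V where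
  toFun x := sandwich α x β
  map_add' x y := by
    ext i j
    simp [sandwich, Finset.sum_add_distrib]
  map_smul' c x := by
    ext i j
    simp only [sandwich, Matrix.smul_apply, RingHom.id_apply, Finset.smul_sum]
    refine Finset.sum_congr rfl fun _ _ => Finset.sum_congr rfl fun _ _ => smul_comm _ _ _

end Sandwich

/-! ### Hilbert-Schmidt norms -/

section HilbertSchmidt

variable {ι κ : Type} [Fintype ι] [Fintype κ]

/-- The square of the Hilbert-Schmidt norm. -/
noncomputable def hsSq (A : Matrix ι κ ℂ) : ℝ := ∑ i, ∑ j, ‖A i j‖ ^ 2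

theorem hsSq_eq_trace (A : Matrix ι κ ℂ) : hsSq A = (A.conjTranspose * A).trace.re := by
  have h : ((hsSq A : ℝ) : ℂ) = (A.conjTranspose * A).trace := by
    simp only [hsSq, Matrix.trace, Matrix.diag, Matrix.mul_apply, Matrix.conjTranspose_apply]
    push_cast
    rw [Finset.sum_comm]
    refine Finset.sum_congr rfl fun i _ => Finset.sum_congr rfl fun j _ => ?_
    rw [RCLike.star_def, mul_comm, RCLike.mul_conj]
    norm_cast
  rw [← h, Complex.ofReal_re]

theorem hsSq_conjTranspose (A : Matrix ι κ ℂ) : hsSq A.conjTranspose = hsSq A := by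
  unfold hsSq
  rw [Finset.sum_comm]
  simp

/-- It suffices to test at ξ = Aη, where the form equals ‖Aη‖². The additive bound is the shape in
which a sum p(αα*) + q(β*β) dominates a functional. -/
theorem norm_le_one_of_forall_re_sesq [DecidableEq ι] {A : Matrix ι ι ℂ}
    (h : ∀ ξ η : EuclideanSpace ℂ ι,
      2 * (∑ i, ∑ j, star (ξ i) * A i j * η j).re ≤ ‖ξ‖ ^ 2 + ‖η‖ ^ 2) : ‖A‖ ≤ 1 := by
  rw [Matrix.l2_opNorm_def]
  refine ContinuousLinearMap.opNorm_le_bound _ zero_le_one fun η => ?_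
  set ξ := ((Matrix.toEuclideanLin.trans LinearMap.toContinuousLinearMap) A) η with hξ
  have h1 : (∑ i, ∑ j, star (ξ i) * A i j * η j) = ((‖ξ‖ ^ 2 : ℝ) : ℂ) := by
    rw [EuclideanSpace.norm_sq_eq]
    push_cast
    refine Finset.sum_congr rfl fun i _ => ?_
    have : ξ i = ∑ j, A i j * η j := by
      simp [hξ, Matrix.toEuclideanLin, Matrix.mulVec, dotProduct]
    simp_rw [mul_assoc]
    rw [← Finset.mul_sum, ← this, ← starRingEnd_apply, mul_comm, RCLike.mul_conj]
    norm_cast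
  have h2 := h ξ η
  rw [h1, Complex.ofReal_re] at h2
  rw [one_mul]
  exact le_of_sq_le_sq (by linarith) (norm_nonneg _)

theorem norm_sesq_le [DecidableEq ι] (A : Matrix ι ι ℂ) (ξ η : EuclideanSpace ℂ ι) :
    ‖∑ i, ∑ j, star (ξ i) * A i j * η j‖ ≤ ‖A‖ * ‖ξ‖ * ‖η‖ := by
  set ζ := ((Matrix.toEuclideanLin.trans LinearMap.toContinuousLinearMap) A) η with hζ
  have h1 : (∑ i, ∑ j, star (ξ i) * A i j * η j) = inner ℂ ξ ζ := by
    rw [PiLp.inner_apply]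
    refine Finset.sum_congr rfl fun i _ => ?_
    have : ζ i = ∑ j, A i j * η j := by
      simp [hζ, Matrix.toEuclideanLin, Matrix.mulVec, dotProduct]
    simp_rw [mul_assoc]
    rw [← Finset.mul_sum, ← this, RCLike.inner_apply, mul_comm]
    rfl
  have h2 : ‖ζ‖ ≤ ‖A‖ * ‖η‖ := by
    rw [Matrix.l2_opNorm_def]
    exact ContinuousLinearMap.le_opNorm _ _
  rw [h1]
  calc _ ≤ ‖ξ‖ * ‖ζ‖ := norm_inner_le_norm _ _
    _ ≤ ‖ξ‖ * (‖A‖ * ‖η‖) := by gcongr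
    _ = _ := by ring

open scoped ComplexOrder MatrixOrder in
/-- A positive functional of norm at most one on the matrices is dominated by `a ↦ tr (S a Sᴴ)`
for an invertible `S` of Hilbert-Schmidt norm arbitrarily close to one. -/
theorem exists_invertible_dominating [DecidableEq ι] (g : Matrix ι ι ℂ →ₗ[ℂ] ℂ)
    (hg : (g 1).re ≤ 1)
    (hpos : ∀ α : Matrix ι Unit ℂ, 0 ≤ (g (α * α.conjTranspose)).re) {δ : ℝ} (hδ : 1 < δ) :
    ∃ S : Matrix ι ι ℂ, IsUnit S ∧ hsSq S ≤ δ ∧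
      ∀ {κ : Type} [Fintype κ] (α : Matrix ι κ ℂ),
        (g (α * α.conjTranspose)).re ≤ hsSq (S * α) := by
  -- The density matrix of g: g(a) = tr(Pa).
  let P : Matrix ι ι ℂ := Matrix.of fun i j => g (Matrix.single j i 1)
  have hP : ∀ a, g a = (P * a).trace := by
    intro a
    conv_lhs => rw [Matrix.matrix_eq_sum_single a]
    simp only [map_sum, Matrix.trace, Matrix.diag, Matrix.mul_apply, P, Matrix.of_apply]
    rw [Finset.sum_comm]
    refine Finset.sum_congr rfl fun i _ => Finset.sum_congr rfl fun j _ => ?_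
    have : Matrix.single j i (a j i) = a j i • (Matrix.single j i 1 : Matrix ι ι ℂ) := by
      rw [Matrix.smul_single, smul_eq_mul, mul_one]
    rw [this, map_smul, smul_eq_mul, mul_comm]
  -- Adding ε to the density makes it invertible and raises its trace by ε times the size, which
  -- stays below δ - 1. The summand 1 in the denominator covers empty ι.
  let ε : ℝ := (δ - 1) / (Fintype.card ι + 1)
  have hε : 0 < ε := by
    have : 0 < δ - 1 := by linarith
    positivity
  -- Positivity is known only for the real part of g, so P need not be Hermitian. Its Hermitian part
  -- gives the same real values on the Hermitian matrices αα*.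
  let H : Matrix ι ι ℂ := (2⁻¹ : ℂ) • (P + P.conjTranspose)
  have hH : H.IsHermitian := by
    unfold H Matrix.IsHermitian
    rw [Matrix.conjTranspose_smul, Matrix.conjTranspose_add, Matrix.conjTranspose_conjTranspose,
      add_comm]
    simp
  have hHt : ∀ {κ : Type} [Fintype κ] (α : Matrix ι κ ℂ),
      (α.conjTranspose * H * α).trace.re = (g (α * α.conjTranspose)).re := by
    intro κ _ α
    have h1 : (α.conjTranspose * P.conjTranspose * α).trace =
        star ((α.conjTranspose * P * α).trace) := by
      rw [← Matrix.trace_conjTranspose]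
      simp only [Matrix.conjTranspose_mul, Matrix.conjTranspose_conjTranspose, Matrix.mul_assoc]
    have h2 : (α.conjTranspose * P * α).trace = g (α * α.conjTranspose) := by
      rw [hP, Matrix.mul_assoc, Matrix.trace_mul_comm, Matrix.mul_assoc]
    simp only [H, Matrix.mul_smul, Matrix.smul_mul, Matrix.mul_add, Matrix.add_mul,
      Matrix.trace_smul, Matrix.trace_add, h1, h2, smul_eq_mul]
    simp [Complex.mul_re]
    ring
  have hHpos : H.PosSemidef := by
    refine Matrix.PosSemidef.of_dotProduct_mulVec_nonneg hH fun v => ?_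
    have h1 := hpos (Matrix.of fun i _ => v i)
    rw [← hHt] at h1
    have h2 : ((Matrix.of fun i (_ : Unit) => v i).conjTranspose * H *
        (Matrix.of fun i (_ : Unit) => v i)).trace = star v ⬝ᵥ H.mulVec v := by
      simp [Matrix.trace, Matrix.mul_assoc, Matrix.mul_apply, dotProduct, Matrix.mulVec]
    rw [h2] at h1
    have h3 := hH.im_star_dotProduct_mulVec_self v
    rw [Complex.le_def]
    exact ⟨h1, h3.symm⟩
  have hpd : (H + (ε : ℂ) • (1 : Matrix ι ι ℂ)).PosDef :=
    Matrix.PosDef.posSemidef_add hHpos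
      (Matrix.PosDef.one.smul (by exact_mod_cast hε))
  -- With H + ε = S*S, the squared Hilbert-Schmidt norm of Sα is Re g(αα*) plus ε times that of α.
  obtain ⟨S, hS⟩ := CStarAlgebra.nonneg_iff_eq_star_mul_self.1 hpd.posSemidef.nonneg
  rw [Matrix.star_eq_conjTranspose] at hS
  have hmul : ∀ {κ : Type} [Fintype κ] (α : Matrix ι κ ℂ),
      hsSq (S * α) = (g (α * α.conjTranspose)).re + ε * hsSq α := by
    intro κ _ α
    rw [hsSq_eq_trace, hsSq_eq_trace, ← hHt, Matrix.conjTranspose_mul, Matrix.mul_assoc,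
      ← Matrix.mul_assoc S.conjTranspose, ← hS]
    simp [Matrix.mul_add, Matrix.add_mul, Matrix.mul_assoc]
  refine ⟨S, ?_, ?_, fun α => ?_⟩
  · have := hpd.isUnit
    rw [hS] at this
    exact isUnit_of_mul_isUnit_right this
  · have h1 := hmul (1 : Matrix ι ι ℂ)
    have h2 : hsSq (1 : Matrix ι ι ℂ) = Fintype.card ι := by
      rw [hsSq_eq_trace]
      simp
    have h3 : ε * (Fintype.card ι + 1) = δ - 1 := div_mul_cancel₀ _ (by positivity)
    simp only [Matrix.mul_one, Matrix.conjTranspose_one, h2] at h1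
    nlinarith
  · rw [hmul]
    have : 0 ≤ hsSq α := by unfold hsSq; positivity
    nlinarith

end HilbertSchmidt

/-! ### Separation of matrices by complete contractions -/

namespace OperatorSpaceStructure

variable {V : Type*} [AddCommGroup V] [Module ℂ V] (E : OperatorSpaceStructure V)

section

variable {ι : Type} [Fintype ι]

theorem exists_norming_functional (x : Matrix ι ι V) :
    ∃ F : Matrix ι ι V →ₗ[ℂ] ℂ, (∀ y, ‖F y‖ ≤ E.mnorm y) ∧ F x = E.mnorm x := by
  let p : AddGroupNorm (Matrix ι ι V) :=
    { toFun := E.mnorm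
      map_zero' := E.mnorm_zero
      add_le' := E.mnorm_add_le
      neg' := fun v => by simpa using E.mnorm_smul (-1) v
      eq_zero_of_map_eq_zero' := fun _ => E.eq_zero_of_mnorm }
  let _ : NormedAddCommGroup (Matrix ι ι V) := p.toNormedAddCommGroup
  let _ : NormedSpace ℂ (Matrix ι ι V) := { norm_smul_le := fun c v => le_of_eq (E.mnorm_smul c v) }
  obtain ⟨g, hg, hx⟩ := exists_dual_vector'' ℂ x
  exact ⟨g.toLinearMap, fun y => (g.le_opNorm y).trans
    (mul_le_of_le_one_left (norm_nonneg y) hg), hx⟩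

/-- The triples (αα*, β*β, 2F(αxβ)) with x in the unit ball form a convex cone K: two of them are
added by juxtaposing α, α' as columns and β, β' as rows around x ⊕ x', which again lies in the unit
ball. The cone misses the open convex set U of triples (a, b, z) with ‖a‖ + ‖b‖ < Re z, because
|2F(αxβ)| ≤ 2‖α‖‖β‖ ≤ ‖αα*‖ + ‖β*β‖. A separating functional, scaled to have coefficient -1 at Re z,
has the required g and h as its other two components. The inner size κ must be arbitrary for K to be
closed under sums. -/
theorem exists_dominating_functionals [DecidableEq ι] (F : Matrix ι ι V →ₗ[ℂ] ℂ)
    (hF : ∀ x, ‖F x‖ ≤ E.mnorm x) :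
    ∃ g h : Matrix ι ι ℂ →ₗ[ℂ] ℂ, (∀ a, (g a).re ≤ ‖a‖) ∧ (∀ a, (h a).re ≤ ‖a‖) ∧
      ∀ {κ : Type} [Fintype κ] (α : Matrix ι κ ℂ) (x : Matrix κ κ V) (β : Matrix κ ι ℂ),
        E.mnorm x ≤ 1 → 2 * (F (sandwich α x β)).re ≤
          (g (α * α.conjTranspose)).re + (h (β.conjTranspose * β)).re := by
  let U : Set ((Matrix ι ι ℂ × Matrix ι ι ℂ) × ℂ) := {p | ‖p.1.1‖ + ‖p.1.2‖ < p.2.re}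
  let K : Set ((Matrix ι ι ℂ × Matrix ι ι ℂ) × ℂ) := {p | ∃ (κ : Type) (_ : Fintype κ)
    (α : Matrix ι κ ℂ) (x : Matrix κ κ V) (β : Matrix κ ι ℂ), E.mnorm x ≤ 1 ∧
      p = ((α * α.conjTranspose, β.conjTranspose * β), 2 * F (sandwich α x β))}
  have hUo : IsOpen U := isOpen_lt (by fun_prop) (by fun_prop)
  have hUc : Convex ℝ U := by
    rintro p hp q hq s t hs ht hst
    simp only [U, Set.mem_ofPred_eq] at hp hq ⊢
    have h1 : ‖s • p.1.1 + t • q.1.1‖ ≤ s * ‖p.1.1‖ + t * ‖q.1.1‖ := by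
      refine (norm_add_le _ _).trans (le_of_eq ?_)
      rw [norm_smul, norm_smul, Real.norm_of_nonneg hs, Real.norm_of_nonneg ht]
    have h2 : ‖s • p.1.2 + t • q.1.2‖ ≤ s * ‖p.1.2‖ + t * ‖q.1.2‖ := by
      refine (norm_add_le _ _).trans (le_of_eq ?_)
      rw [norm_smul, norm_smul, Real.norm_of_nonneg hs, Real.norm_of_nonneg ht]
    simp only [Prod.fst_add, Prod.snd_add, Prod.smul_fst, Prod.smul_snd, Complex.add_re,
      Complex.real_smul, Complex.re_ofReal_mul]
    -- The strict inequality comes from a positive weight, and s may vanish.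
    rcases hs.eq_or_lt with h0 | h0
    · have : t = 1 := by linarith
      subst this
      subst h0
      nlinarith
    · nlinarith
  have hKs : ∀ (s : ℝ), 0 ≤ s → ∀ p ∈ K, s • p ∈ K := by
    rintro s hs _ ⟨κ, _, α, x, β, hx, rfl⟩
    -- All three components are of degree two in (α, β), so each of these matrices takes a factor
    -- √s.
    refine ⟨κ, inferInstance, ((√s : ℝ) : ℂ) • α, x, ((√s : ℝ) : ℂ) • β, hx, ?_⟩
    have h1 : ((√s : ℝ) : ℂ) * ((√s : ℝ) : ℂ) = (s : ℂ) := by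
      rw [← Complex.ofReal_mul, Real.mul_self_sqrt hs]
    have h2 : sandwich (((√s : ℝ) : ℂ) • α) x (((√s : ℝ) : ℂ) • β) = (s : ℂ) • sandwich α x β := by
      ext i j
      simp only [sandwich, Matrix.smul_apply, Finset.smul_sum, smul_smul, ← h1, smul_eq_mul]
      refine Finset.sum_congr rfl fun _ _ => Finset.sum_congr rfl fun _ _ => ?_
      congr 1
      ring
    ext : 1
    · have h3 : ∀ a : Matrix ι ι ℂ, s • a = (s : ℂ) • a := fun _ => rfl
      ext : 1 <;> simp only [Matrix.conjTranspose_smul, RCLike.star_def, Complex.conj_ofReal,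
        Matrix.smul_mul, Matrix.mul_smul, smul_smul, h1, h3, Prod.smul_fst, Prod.smul_snd]
    · simp only [h2, map_smul, Prod.smul_snd, smul_eq_mul, Complex.real_smul]
      ring
  have hKa : ∀ p ∈ K, ∀ q ∈ K, p + q ∈ K := by
    rintro _ ⟨κ, _, α, x, β, hx, rfl⟩ _ ⟨κ', _, α', x', β', hx', rfl⟩
    refine ⟨κ ⊕ κ', inferInstance, Matrix.fromCols α α', Matrix.fromBlocks x 0 0 x',
      Matrix.fromRows β β', ?_, ?_⟩
    · rw [mnorm_fromBlocks]
      exact max_le hx hx'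
    · have h2 : sandwich (Matrix.fromCols α α') (Matrix.fromBlocks x 0 0 x')
          (Matrix.fromRows β β') = sandwich α x β + sandwich α' x' β' := by
        ext i j
        simp [sandwich]
      ext : 1
      · ext : 1
        · simp [Matrix.conjTranspose_fromCols_eq_fromRows_conjTranspose,
            Matrix.fromCols_mul_fromRows]
        · simp [Matrix.conjTranspose_fromRows_eq_fromCols_conjTranspose,
            Matrix.fromCols_mul_fromRows]
      · simp [h2, mul_add]
  have hKc : Convex ℝ K := fun p hp q hq s t hs ht _ => hKa _ (hKs s hs p hp) _ (hKs t ht q hq)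
  have hdisj : Disjoint U K := by
    rw [Set.disjoint_left]
    rintro _ hU ⟨κ, _, α, x, β, hx, rfl⟩
    classical
    simp only [U, Set.mem_ofPred_eq] at hU
    have h1 : ‖α * α.conjTranspose‖ = ‖α‖ * ‖α‖ := by
      have := Matrix.l2_opNorm_conjTranspose_mul_self α.conjTranspose
      rwa [Matrix.conjTranspose_conjTranspose, Matrix.l2_opNorm_conjTranspose] at this
    rw [h1, Matrix.l2_opNorm_conjTranspose_mul_self] at hU
    have h2 : (2 * F (sandwich α x β)).re ≤ 2 * (‖α‖ * ‖β‖) := by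
      refine (Complex.re_le_norm _).trans ?_
      rw [norm_mul, Complex.norm_two]
      refine mul_le_mul_of_nonneg_left ((hF _).trans ((E.mnorm_sandwich_le' α x β).trans ?_))
        zero_le_two
      gcongr
      exact mul_le_of_le_one_right (norm_nonneg _) hx
    nlinarith [sq_nonneg (‖α‖ - ‖β‖)]
  obtain ⟨f, u, hfU, hfK⟩ := RCLike.geometric_hahn_banach_open (𝕜 := ℂ) hUc hUo hKc hdisj
  simp only [RCLike.re_to_complex] at hfU hfK
  have hfr : ∀ (s : ℝ) p, (f (s • p)).re = s * (f p).re := by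
    intro s p
    have : s • p = (s : ℂ) • p := rfl
    rw [this, map_smul, smul_eq_mul, Complex.re_ofReal_mul]
  -- The empty inner index type exhibits 0 in K, which forces the separating constant to be
  -- nonpositive.
  have h0K : (0 : (Matrix ι ι ℂ × Matrix ι ι ℂ) × ℂ) ∈ K :=
    ⟨PEmpty, inferInstance, 0, 0, 0, by rw [mnorm_zero]; exact zero_le_one, by
      rw [sandwich_zero, map_zero, mul_zero, Matrix.zero_mul, Matrix.mul_zero]
      rfl⟩
  have hu : u ≤ 0 := by simpa using hfK 0 h0K
  -- A negative value at a point of the cone could be scaled below u.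
  have hK0 : ∀ p ∈ K, 0 ≤ (f p).re := by
    intro p hp
    by_contra! hlt
    have h1 := hfK _ (hKs ((u - 1) / (f p).re)
      (div_nonneg_of_nonpos (by linarith) hlt.le) p hp)
    rw [hfr, div_mul_cancel₀ _ hlt.ne] at h1
    linarith
  have hU0 : ∀ p ∈ U, (f p).re < 0 := fun p hp => (hfU p hp).trans_le hu
  set c : ℂ := f (0, 1) with hc
  have hcs : ∀ z : ℂ, f (0, z) = z * c := by
    intro z
    rw [hc, ← smul_eq_mul, ← map_smul]
    simp
  have hcre : c.re < 0 := hU0 (0, 1) (by simp [U])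
  -- U leaves Im z free, so Re f cannot depend on it: otherwise the imaginary part chosen here would
  -- cancel Re f at a point of U.
  have hcim : c.im = 0 := by
    by_contra hne
    have h1 := hU0 (0, 1 + ((c.re / c.im : ℝ) : ℂ) * Complex.I) (by simp [U])
    rw [hcs] at h1
    simp at h1
    rw [div_mul_cancel₀ _ hne] at h1
    linarith
  have hsplit : ∀ a b z, (f ((a, b), z)).re =
      (f ((a, 0), 0)).re + (f ((0, b), 0)).re + z.re * c.re := by
    intro a b z
    have h1 : ((a, b), z) = ((a, 0), 0) + ((0, b), 0) + ((0 : Matrix ι ι ℂ × Matrix ι ι ℂ), z) := by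
      simp
    rw [h1, map_add, map_add, hcs]
    simp [hcim]
  -- The scaling that turns the coefficient of Re z into -1.
  let d : ℂ := ((-c.re)⁻¹ : ℝ)
  have hd : 0 < (-c.re)⁻¹ := inv_pos.2 (by linarith)
  have hscale : ∀ A t : ℝ, (-c.re)⁻¹ * (A + t * c.re) = (-c.re)⁻¹ * A - t := by
    intro A t
    have := hcre.ne
    field_simp
    ring
  have hz : f ((0, 0), 0) = 0 := map_zero f
  let g : Matrix ι ι ℂ →ₗ[ℂ] ℂ :=
    d • (f.toLinearMap ∘ₗ LinearMap.inl ℂ _ _ ∘ₗ LinearMap.inl ℂ _ _)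
  let h : Matrix ι ι ℂ →ₗ[ℂ] ℂ :=
    d • (f.toLinearMap ∘ₗ LinearMap.inl ℂ _ _ ∘ₗ LinearMap.inr ℂ _ _)
  have hg : ∀ a, (g a).re = (-c.re)⁻¹ * (f ((a, 0), 0)).re := fun a => by
    simp [g, d]
  have hh : ∀ a, (h a).re = (-c.re)⁻¹ * (f ((0, a), 0)).re := fun a => by
    simp [h, d]
  refine ⟨g, h, fun a => ?_, fun b => ?_, fun {κ} _ α x β hx => ?_⟩
  · refine le_of_forall_gt fun t ht => ?_
    have h1 := hU0 ((a, 0), t) (by simpa [U] using ht)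
    rw [hsplit] at h1
    have h2 := mul_neg_of_pos_of_neg hd h1
    rw [hscale] at h2
    rw [hg]
    simp only [hz, Complex.zero_re, add_zero, Complex.ofReal_re] at h2
    linarith
  · refine le_of_forall_gt fun t ht => ?_
    have h1 := hU0 ((0, b), t) (by simpa [U] using ht)
    rw [hsplit] at h1
    have h2 := mul_neg_of_pos_of_neg hd h1
    rw [hscale] at h2
    rw [hh]
    simp only [hz, Complex.zero_re, zero_add, Complex.ofReal_re] at h2
    linarith
  · have h1 := hK0 _ ⟨κ, inferInstance, α, x, β, hx, rfl⟩
    rw [hsplit] at h1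
    have h2 := mul_nonneg hd.le h1
    rw [hscale, mul_add, show ∀ z : ℂ, (2 * z).re = 2 * z.re from fun z => by simp] at h2
    rw [hg, hh]
    linarith

end

end OperatorSpaceStructure

/-! ### Amplifications of bilinear maps -/

section Amplification

variable {V W U ι κ : Type*} [AddCommGroup V] [Module ℂ V] [AddCommGroup W] [Module ℂ W]
  [AddCommGroup U] [Module ℂ U]

/-- The amplification `[b (xᵢⱼ, yₖₗ)]` of a bilinear map. -/
def amp (b : V →ₗ[ℂ] W →ₗ[ℂ] U) (x : Matrix ι ι V) (y : Matrix κ κ W) :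
    Matrix (ι × κ) (ι × κ) U :=
  Matrix.of fun p q => b (x p.1 q.1) (y p.2 q.2)

@[simp]
theorem amp_apply (b : V →ₗ[ℂ] W →ₗ[ℂ] U) (x : Matrix ι ι V) (y : Matrix κ κ W)
    (p q : ι × κ) : amp b x y p q = b (x p.1 q.1) (y p.2 q.2) := rfl

end Amplification

namespace OperatorSpaceStructure

variable {V W U : Type*} [AddCommGroup V] [Module ℂ V] [AddCommGroup W] [Module ℂ W]
  [AddCommGroup U] [Module ℂ U] (E : OperatorSpaceStructure V) (F : OperatorSpaceStructure W)
  (G : OperatorSpaceStructure U)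

theorem mnorm_amp_flip {ι κ : Type} [Fintype ι] [Fintype κ] (b : V →ₗ[ℂ] W →ₗ[ℂ] U)
    (x : Matrix ι ι V) (y : Matrix κ κ W) : G.mnorm (amp b.flip y x) = G.mnorm (amp b x y) :=
  G.mnorm_reindex (Equiv.prodComm κ ι) (amp b x y)

theorem mnorm_amp_submatrix {ι κ ι' κ' : Type} [Fintype ι] [Fintype κ] [Fintype ι'] [Fintype κ']
    (b : V →ₗ[ℂ] W →ₗ[ℂ] U) (e : ι' ≃ ι) (e' : κ' ≃ κ) (x : Matrix ι ι V) (y : Matrix κ κ W) :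
    G.mnorm (amp b (x.submatrix e e) (y.submatrix e' e')) = G.mnorm (amp b x y) :=
  G.mnorm_reindex (e.prodCongr e') (amp b x y)

theorem mnorm_map_submatrix {ι ι' : Type} [Fintype ι] [Fintype ι']
    (f : V →ₗ[ℂ] W) (e : ι' ≃ ι) (x : Matrix ι ι V) :
    F.mnorm ((x.submatrix e e).map f) = F.mnorm (x.map f) :=
  F.mnorm_reindex e (x.map f)

theorem complex_mnorm {ι : Type} [Fintype ι] [DecidableEq ι] (A : Matrix ι ι ℂ) :
    complex.mnorm A = ‖A‖ := by
  refine le_antisymm (norm_submatrix_equiv_le _ _) ?_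
  have h := norm_submatrix_equiv_le (Fintype.equivFin ι)
    (A.submatrix (Fintype.equivFin ι).symm (Fintype.equivFin ι).symm)
  rw [Matrix.submatrix_submatrix, Equiv.symm_comp_self, Matrix.submatrix_id_id] at h
  exact h

/-- Here the blocks are nested in the opposite order to `amp`; the norm does not see the difference.
-/
theorem nrm_matrix_map {m n : ℕ} (φ : Matrix (Fin n) (Fin n) (V →ₗ[ℂ] W))
    (x : Matrix (Fin m) (Fin m) V) :
    (F.matrix n).nrm m (x.map (toMatrixMap V W n φ)) = F.mnorm (amp LinearMap.id φ x) := by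
  rw [nrm_matrix, ← mnorm_amp_flip]
  rfl

/-! ### Matrix norms of CB(V, W) through amplifications -/

section cb

variable [FiniteDimensional ℂ V]

theorem mnorm_amp_id_le {ι κ : Type} [Fintype ι] [Fintype κ] (φ : Matrix κ κ (V →ₗ[ℂ] W))
    (x : Matrix ι ι V) :
    F.mnorm (amp LinearMap.id φ x) ≤ (E.cb F).mnorm φ * E.mnorm x := by
  have h := nrm_map_le_cbNorm E (F.matrix (Fintype.card κ)) (toMatrixMap V W _
    (φ.submatrix (Fintype.equivFin κ).symm (Fintype.equivFin κ).symm)) (Fintype.card ι)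
    (x.submatrix (Fintype.equivFin ι).symm (Fintype.equivFin ι).symm)
  rw [nrm_matrix_map, mnorm_amp_submatrix] at h
  exact h

theorem mnorm_cb_le {κ : Type} [Fintype κ] (φ : Matrix κ κ (V →ₗ[ℂ] W)) {C : ℝ} (hC : 0 ≤ C)
    (h : ∀ (n : ℕ) (x : Matrix (Fin n) (Fin n) V),
      F.mnorm (amp LinearMap.id φ x) ≤ C * E.mnorm x) : (E.cb F).mnorm φ ≤ C := by
  refine cbNorm_le E _ hC fun n x => ?_
  rw [nrm_matrix_map, ← mnorm_fin]
  refine le_trans (le_of_eq ?_) (h n x)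
  exact F.mnorm_amp_submatrix LinearMap.id (Fintype.equivFin κ).symm (Equiv.refl (Fin n)) φ x

/-- Domination of functionals is available on the unit ball only, hence this form beside the
homogeneous one. -/
theorem mnorm_cb_le_of_unit_ball {κ : Type} [Fintype κ] (φ : Matrix κ κ (V →ₗ[ℂ] W)) {C : ℝ}
    (hC : 0 ≤ C) (h : ∀ (n : ℕ) (x : Matrix (Fin n) (Fin n) V), E.mnorm x ≤ 1 →
      F.mnorm (amp LinearMap.id φ x) ≤ C) : (E.cb F).mnorm φ ≤ C := by
  refine Real.sSup_le ?_ hC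
  rintro r ⟨n, x, hx, rfl⟩
  rw [nrm_matrix_map]
  refine le_trans (le_of_eq ?_) (h n x (by rwa [mnorm_fin]))
  exact F.mnorm_amp_submatrix LinearMap.id (Fintype.equivFin κ).symm (Equiv.refl (Fin n)) φ x

end cb

/-! ### Matrices are separated by complete contractions -/

/-- The matrix norms of a finite-dimensional operator space are determined by the completely
bounded maps to matrix algebras. -/
theorem mnorm_le_of_dual [FiniteDimensional ℂ V] {ι : Type} [Fintype ι] (x : Matrix ι ι V) {C : ℝ}
    (hC : 0 ≤ C)
    (h : ∀ (k : ℕ) (φ : Matrix (Fin k) (Fin k) (V →ₗ[ℂ] ℂ)),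
      complex.mnorm (amp LinearMap.id φ x) ≤ (E.cb complex).mnorm φ * C) : E.mnorm x ≤ C := by
  classical
  obtain ⟨F, hF, hFx⟩ := E.exists_norming_functional x
  obtain ⟨p, q, hp, hq, hpq⟩ := E.exists_dominating_functionals F hF
  have hone : ‖(1 : Matrix ι ι ℂ)‖ ≤ 1 := norm_le_one_of_conjTranspose_mul_self (by simp)
  -- The perturbation making the weights invertible costs a factor δ > 1, absorbed by proving the
  -- bound for every B > C. The denominator C + 1 below allows C = 0.
  refine le_of_forall_gt_imp_ge_of_dense fun B hB => ?_
  obtain ⟨δ, hδ, hδB⟩ : ∃ δ : ℝ, 1 < δ ∧ C * δ ≤ B := by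
    refine ⟨1 + (B - C) / (C + 1), ?_, ?_⟩
    · have : 0 < B - C := by linarith
      have : 0 < (B - C) / (C + 1) := by positivity
      linarith
    · have h1 : (B - C) / (C + 1) * (C + 1) = B - C := div_mul_cancel₀ _ (by positivity)
      have h2 : 0 ≤ (B - C) / (C + 1) := div_nonneg (by linarith) (by positivity)
      nlinarith
  have h0 : E.mnorm (0 : Matrix Unit Unit V) ≤ 1 := by
    rw [mnorm_zero]
    exact zero_le_one
  -- Domination at x = 0 with one of α, β equal to zero yields the positivity of p and of q.
  have hp0 : ∀ α : Matrix ι Unit ℂ, 0 ≤ (p (α * α.conjTranspose)).re := fun α => by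
    simpa [sandwich_zero] using hpq α 0 0 h0
  have hq0 : ∀ α : Matrix ι Unit ℂ, 0 ≤ (q (α * α.conjTranspose)).re := fun α => by
    simpa [sandwich_zero] using hpq 0 0 α.conjTranspose h0
  obtain ⟨S, hS, hSδ, hSp⟩ := exists_invertible_dominating p ((hp 1).trans hone) hp0 hδ
  obtain ⟨T, hT, hTδ, hTq⟩ := exists_invertible_dominating q ((hq 1).trans hone) hq0 hδ
  rw [Matrix.isUnit_iff_isUnit_det] at hS hT
  -- q is evaluated at β*β, so T acts on β*; on β itself the weight is T*, from the right.
  let R : Matrix ι ι ℂ := T.conjTranspose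
  have hR : IsUnit R.det := by
    rw [Matrix.det_conjTranspose]
    exact hT.star
  -- These are the components of y ↦ F(S⁻¹ y R⁻¹), the functional F divided by its weights.
  let φ : Matrix ι ι (V →ₗ[ℂ] ℂ) := Matrix.of fun k l =>
    F ∘ₗ sandwichₗ S⁻¹ R⁻¹ ∘ₗ Matrix.singleLinearMap ℂ k l
  have hφ : ∀ y : Matrix ι ι V, ∑ k, ∑ l, φ k l (y k l) = F (sandwich S⁻¹ y R⁻¹) := by
    intro y
    have : sandwich S⁻¹ y R⁻¹ = sandwichₗ S⁻¹ R⁻¹ y := rfl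
    rw [this]
    conv_rhs => rw [Matrix.matrix_eq_sum_single y]
    simp only [map_sum]
    rfl
  have hsum : ∀ {κ : Type} [Fintype κ] (y : Matrix κ κ V) (ξ η : ι × κ → ℂ),
      ∑ i, ∑ j, ξ i * amp LinearMap.id φ y i j * η j =
        F (sandwich (S⁻¹ * Matrix.of fun i k => ξ (i, k)) y
          ((Matrix.of fun k i => η (i, k)) * R⁻¹)) := by
    intro κ _ y ξ η
    rw [← sandwich_sandwich, ← hφ]
    simp only [sandwich, map_sum, map_smul, smul_eq_mul, Fintype.sum_prod_type, amp_apply,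
      LinearMap.id_apply, Matrix.of_apply]
    refine Finset.sum_congr rfl fun i _ => ?_
    rw [Finset.sum_comm]
    refine Finset.sum_congr rfl fun j _ => Finset.sum_congr rfl fun k _ =>
      Finset.sum_congr rfl fun l _ => ?_
    ring
  -- Read as rectangular matrices, the vectors ξ, η give α = S⁻¹ξ* and β = ηR⁻¹ in the domination
  -- inequality. The weights cancel, leaving ‖ξ‖² + ‖η‖².
  have hφ1 : (E.cb complex).mnorm φ ≤ 1 := by
    refine E.mnorm_cb_le_of_unit_ball _ _ zero_le_one fun n y hy => ?_
    rw [complex_mnorm]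
    refine norm_le_one_of_forall_re_sesq fun ξ η => ?_
    rw [hsum y (fun i => star (ξ i)) η]
    refine (hpq _ _ _ hy).trans (add_le_add ((hSp _).trans ?_) ?_)
    · rw [← Matrix.mul_assoc, Matrix.mul_nonsing_inv _ hS, Matrix.one_mul,
        EuclideanSpace.norm_sq_eq, Fintype.sum_prod_type]
      simp [hsSq]
    · have h1 := hTq ((Matrix.of fun k i => η (i, k)) * R⁻¹ : Matrix (Fin n) ι ℂ).conjTranspose
      rw [Matrix.conjTranspose_conjTranspose] at h1
      refine h1.trans (le_of_eq ?_)
      rw [← hsSq_conjTranspose, Matrix.conjTranspose_mul, Matrix.conjTranspose_conjTranspose,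
        Matrix.mul_assoc, Matrix.nonsing_inv_mul _ hR, Matrix.mul_one,
        EuclideanSpace.norm_sq_eq, Fintype.sum_prod_type, Finset.sum_comm]
      simp [hsSq]
  obtain ⟨k, e⟩ : ∃ k, Nonempty (ι ≃ Fin k) := ⟨_, ⟨Fintype.equivFin ι⟩⟩
  obtain ⟨e⟩ := e
  have h1 := h k (φ.submatrix e.symm e.symm)
  have h2 := complex.mnorm_amp_submatrix LinearMap.id e.symm (Equiv.refl ι) φ x
  have h3 : x.submatrix (Equiv.refl ι) (Equiv.refl ι) = x := rfl
  rw [h3] at h2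
  rw [h2, mnorm_reindex, complex_mnorm] at h1
  -- The entries of S (conjugated) and of R, as vectors: they undo the division in φ, so the form
  -- takes the value F(x) = ‖x‖. Their squared norms are those of S and T, at most δ.
  let ξ : EuclideanSpace ℂ (ι × ι) := WithLp.toLp 2 fun i => star (S i.1 i.2)
  let η : EuclideanSpace ℂ (ι × ι) := WithLp.toLp 2 fun i => R i.2 i.1
  have h4 := norm_sesq_le (amp LinearMap.id φ x) ξ η
  have h5 : ∑ i, ∑ j, star (ξ i) * amp LinearMap.id φ x i j * η j = E.mnorm x := by
    rw [hsum x (fun i => star (ξ i)) η, ← hFx]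
    congr 1
    have h6 : (Matrix.of fun i k => star (ξ (i, k))) = S := by
      ext
      simp [ξ]
    have h7 : (Matrix.of fun k i => η (i, k)) = R := rfl
    rw [h6, h7, Matrix.nonsing_inv_mul _ hS, Matrix.mul_nonsing_inv _ hR, sandwich_one]
  rw [h5, Complex.norm_real, Real.norm_of_nonneg (E.mnorm_nonneg x)] at h4
  have h6 : ‖ξ‖ ^ 2 ≤ δ := by
    rw [EuclideanSpace.norm_sq_eq, Fintype.sum_prod_type]
    simpa [ξ, hsSq] using hSδ
  have h7 : ‖η‖ ^ 2 ≤ δ := by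
    rw [EuclideanSpace.norm_sq_eq, Fintype.sum_prod_type]
    simpa [η, R, hsSq] using hTδ
  have h8 : ‖ξ‖ * ‖η‖ ≤ δ := by nlinarith [sq_nonneg (‖ξ‖ - ‖η‖)]
  calc E.mnorm x ≤ ‖amp LinearMap.id φ x‖ * (‖ξ‖ * ‖η‖) := by rw [← mul_assoc]; exact h4
    _ ≤ C * δ := by
      refine mul_le_mul (h1.trans (mul_le_of_le_one_left hC hφ1)) h8 (by positivity) hC
    _ ≤ B := hδB

end OperatorSpaceStructure

/-! ### Complete contractions and jointly completely contractive bilinear maps -/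

namespace OperatorSpaceStructure

section Contractions

variable {V W U V' W' : Type} [AddCommGroup V] [Module ℂ V] [AddCommGroup W] [Module ℂ W]
  [AddCommGroup U] [Module ℂ U] [AddCommGroup V'] [Module ℂ V'] [AddCommGroup W'] [Module ℂ W']
  {E : OperatorSpaceStructure V} {F : OperatorSpaceStructure W} {G : OperatorSpaceStructure U}
  {E' : OperatorSpaceStructure V'} {F' : OperatorSpaceStructure W'}
  {ι κ : Type} [Fintype ι] [Fintype κ]

/-- Complete contractivity of a linear map. -/
def IsCC (E : OperatorSpaceStructure V) (F : OperatorSpaceStructure W) (f : V →ₗ[ℂ] W) : Prop :=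
  ∀ (n : ℕ) (x : Matrix (Fin n) (Fin n) V), F.mnorm (x.map f) ≤ E.mnorm x

theorem IsCC.mnorm_le {f : V →ₗ[ℂ] W} (hf : IsCC E F f) (x : Matrix ι ι V) :
    F.mnorm (x.map f) ≤ E.mnorm x := by
  have h := hf _ (x.submatrix (Fintype.equivFin ι).symm (Fintype.equivFin ι).symm)
  rwa [mnorm_map_submatrix, mnorm_reindex] at h

/-- Joint complete contractivity of a bilinear map. -/
def IsJointlyCC (E : OperatorSpaceStructure V) (F : OperatorSpaceStructure W)
    (G : OperatorSpaceStructure U) (b : V →ₗ[ℂ] W →ₗ[ℂ] U) : Prop :=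
  ∀ (m n : ℕ) (x : Matrix (Fin m) (Fin m) V) (y : Matrix (Fin n) (Fin n) W),
    G.mnorm (amp b x y) ≤ E.mnorm x * F.mnorm y

theorem IsJointlyCC.mnorm_le {b : V →ₗ[ℂ] W →ₗ[ℂ] U} (hb : IsJointlyCC E F G b)
    (x : Matrix ι ι V) (y : Matrix κ κ W) : G.mnorm (amp b x y) ≤ E.mnorm x * F.mnorm y := by
  have h := hb _ _ (x.submatrix (Fintype.equivFin ι).symm (Fintype.equivFin ι).symm)
    (y.submatrix (Fintype.equivFin κ).symm (Fintype.equivFin κ).symm)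
  rwa [mnorm_amp_submatrix, mnorm_reindex, mnorm_reindex] at h

theorem IsJointlyCC.flip {b : V →ₗ[ℂ] W →ₗ[ℂ] U} (hb : IsJointlyCC E F G b) :
    IsJointlyCC F E G b.flip := fun _ _ x y => by
  rw [mnorm_amp_flip, mul_comm]
  exact hb _ _ y x

theorem IsJointlyCC.compr₂ {b : V →ₗ[ℂ] W →ₗ[ℂ] U} {f : U →ₗ[ℂ] V'} (hb : IsJointlyCC E F G b)
    (hf : IsCC G E' f) : IsJointlyCC E F E' (b.compr₂ f) := fun m n x y =>
  (hf.mnorm_le (amp b x y)).trans (hb m n x y)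

theorem IsJointlyCC.compl₁₂ {b : V →ₗ[ℂ] W →ₗ[ℂ] U} {f : V' →ₗ[ℂ] V} {g : W' →ₗ[ℂ] W}
    (hb : IsJointlyCC E F G b) (hf : IsCC E' E f) (hg : IsCC F' F g) :
    IsJointlyCC E' F' G (b.compl₁₂ f g) := fun m n x y =>
  (hb m n (x.map f) (y.map g)).trans
    (mul_le_mul (hf m x) (hg n y) (F.mnorm_nonneg _) (E'.mnorm_nonneg _))

/-- For fixed x, the norm of b(x) over CB(W, U) is the best constant in the bound of the
amplification by the norm of y. This is the tensor-hom adjunction before any tensor product is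
chosen. -/
theorem isJointlyCC_iff_isCC [FiniteDimensional ℂ W] {b : V →ₗ[ℂ] W →ₗ[ℂ] U} :
    IsJointlyCC E F G b ↔ IsCC E (F.cb G) b :=
  ⟨fun hb n x => F.mnorm_cb_le G _ (E.mnorm_nonneg x) fun m y => hb n m x y,
    fun hb m _ x y => (F.mnorm_amp_id_le G (x.map b) y).trans
      (mul_le_mul_of_nonneg_right (hb m x) (F.mnorm_nonneg y))⟩

theorem isJointlyCC_id [FiniteDimensional ℂ V] :
    IsJointlyCC (E.cb F) E F LinearMap.id :=
  fun _ _ φ x => E.mnorm_amp_id_le F φ x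

/-- The matrix is a direct sum of copies of x, so the norm of direct sums and induction on their
number apply. -/
theorem mnorm_diagonal_block_le [DecidableEq κ] (x : Matrix ι ι V) :
    E.mnorm (Matrix.of fun p q : κ × ι => (1 : Matrix κ κ ℂ) p.1 q.1 • x p.2 q.2) ≤
      E.mnorm x := by
  have key : ∀ n : ℕ, E.mnorm (Matrix.of fun p q : Fin n × ι =>
      (1 : Matrix (Fin n) (Fin n) ℂ) p.1 q.1 • x p.2 q.2) ≤ E.mnorm x := by
    intro n
    induction n with
    | zero =>
      refine le_trans (le_of_eq ?_) (E.mnorm_nonneg x)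
      rw [← E.mnorm_zero (ι := Fin 0 × ι)]
      congr 1
      ext p
      exact p.1.elim0
    | succ n ih =>
      let e : Fin (n + 1) × ι ≃ (Fin n × ι) ⊕ ι :=
        ((finSumFinEquiv.symm.trans (Equiv.sumCongr (Equiv.refl _) finOneEquiv)).prodCongr
          (Equiv.refl ι)).trans ((Equiv.sumProdDistrib _ _ _).trans
            (Equiv.sumCongr (Equiv.refl _) (Equiv.punitProd ι)))
      have h := E.mnorm_reindex e.symm (Matrix.of fun p q : Fin (n + 1) × ι =>
        (1 : Matrix (Fin (n + 1)) (Fin (n + 1)) ℂ) p.1 q.1 • x p.2 q.2)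
      rw [← h]
      have h2 := E.mnorm_fromBlocks (Matrix.of fun p q : Fin n × ι =>
        (1 : Matrix (Fin n) (Fin n) ℂ) p.1 q.1 • x p.2 q.2) x
      rw [max_eq_right ih] at h2
      refine le_of_eq (Eq.trans ?_ h2)
      have hne : ∀ k : Fin n, n ≠ k := fun k => k.2.ne'
      congr 1
      ext i j
      rcases i with i | i <;> rcases j with j | j <;>
        simp [e, Matrix.one_apply, Fin.ext_iff, hne, (hne _).symm]
  refine le_trans (le_of_eq ?_) (key (Fintype.card κ))
  rw [← E.mnorm_reindex ((Fintype.equivFin κ).prodCongr (Equiv.refl ι))]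
  congr 1
  ext p q
  simp [Matrix.one_apply]

/-- Factor a ⊗ x = (a ⊗ 1)(1 ⊗ x) and apply Ruan's axioms. Both unit laws rest on this. -/
theorem isJointlyCC_lsmul : IsJointlyCC complex E E (LinearMap.lsmul ℂ V) := by
  intro m n a x
  have h := E.mnorm_sandwich_le (a ⊗ₖ (1 : Matrix (Fin n) (Fin n) ℂ))
    (Matrix.of fun p q : Fin m × Fin n => (1 : Matrix (Fin m) (Fin m) ℂ) p.1 q.1 • x p.2 q.2) 1
  have h' : sandwich (a ⊗ₖ (1 : Matrix (Fin n) (Fin n) ℂ)) (Matrix.of fun p q : Fin m × Fin n =>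
      (1 : Matrix (Fin m) (Fin m) ℂ) p.1 q.1 • x p.2 q.2) 1 =
      amp (LinearMap.lsmul ℂ V) a x := by
    ext p q
    simp [sandwich, Fintype.sum_prod_type, Matrix.one_apply, Prod.ext_iff, ite_and]
  rw [h'] at h
  rw [complex_mnorm]
  have h1 : ‖(1 : Matrix (Fin m × Fin n) (Fin m × Fin n) ℂ)‖ ≤ 1 :=
    norm_le_one_of_conjTranspose_mul_self (by simp)
  have h2 := E.mnorm_diagonal_block_le (κ := Fin m) x
  have h3 := norm_kronecker_one_le (κ := Fin n) a
  have h4 := E.mnorm_nonneg (Matrix.of fun p q : Fin m × Fin n =>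
    (1 : Matrix (Fin m) (Fin m) ℂ) p.1 q.1 • x p.2 q.2)
  have h5 := mul_nonneg (norm_nonneg a) (E.mnorm_nonneg x)
  calc _ ≤ _ := h
    _ ≤ ‖a‖ * E.mnorm x * 1 := by gcongr
    _ = _ := mul_one _

/-! ### Duality -/

/-- The operator space structure of the dual space. -/
noncomputable abbrev dual [FiniteDimensional ℂ V] (E : OperatorSpaceStructure V) :
    OperatorSpaceStructure (V →ₗ[ℂ] ℂ) := E.cb complex

theorem isCC_lcomp [FiniteDimensional ℂ V] [FiniteDimensional ℂ W] {f : V →ₗ[ℂ] W}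
    (hf : IsCC E F f) :
    IsCC (F.cb G) (E.cb G) (LinearMap.lcomp ℂ U f) :=
  fun _ φ => E.mnorm_cb_le G _ (mnorm_nonneg _ _) fun m x =>
    (F.mnorm_amp_id_le G φ (x.map f)).trans
      (mul_le_mul_of_nonneg_left (hf m x) (mnorm_nonneg _ _))

/-- Evaluation at points is the flipped identity of the dual, curried. -/
theorem isCC_eval [FiniteDimensional ℂ V] : IsCC E E.dual.dual (Module.Dual.eval ℂ V) :=
  isJointlyCC_iff_isCC.1 isJointlyCC_id.flip

/-- Separation enters here: the preimage of x is tested against matrices φ over V*, and pairing it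
with φ is the same as pairing x ∈ M(V**) with φ. -/
theorem isCC_evalEquiv_symm [FiniteDimensional ℂ V] :
    IsCC E.dual.dual E (Module.evalEquiv ℂ V).symm.toLinearMap := by
  intro n x
  refine E.mnorm_le_of_dual _ (mnorm_nonneg _ _) fun k φ => ?_
  have h := (isJointlyCC_id (E := E.dual) (F := complex)).flip.mnorm_le φ x
  refine le_trans (le_of_eq ?_) h
  congr 1
  ext p q
  simp only [amp_apply, LinearMap.id_apply, Matrix.map_apply, LinearMap.flip_apply]
  exact Module.apply_evalEquiv_symm_apply ℂ V _ _

/-- A linear map is a complete contraction if its transpose is. -/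
theorem isCC_of_transpose [FiniteDimensional ℂ W] {f : V →ₗ[ℂ] W}
    (hf : IsJointlyCC F.dual E complex (LinearMap.lcomp ℂ ℂ f)) : IsCC E F f :=
  fun n x => F.mnorm_le_of_dual _ (E.mnorm_nonneg x) fun k φ => hf k n φ x

end Contractions

end OperatorSpaceStructure

/-! ### The two tensor products -/

namespace OperatorSpaceStructure

section Tensor

/-- The bilinear map `(g, v ⊗ w) ↦ g(w) v`. -/
noncomputable def sliceRight (V W : Type) [AddCommGroup V] [Module ℂ V] [AddCommGroup W]
    [Module ℂ W] : (W →ₗ[ℂ] ℂ) →ₗ[ℂ] V ⊗[ℂ] W →ₗ[ℂ] V :=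
  LinearMap.compRight ℂ (TensorProduct.rid ℂ V).toLinearMap ∘ₗ LinearMap.lTensorHom V

/-- The bilinear map `(f, v ⊗ w) ↦ f(v) w`. -/
noncomputable def sliceLeft (V W : Type) [AddCommGroup V] [Module ℂ V] [AddCommGroup W]
    [Module ℂ W] : (V →ₗ[ℂ] ℂ) →ₗ[ℂ] V ⊗[ℂ] W →ₗ[ℂ] W :=
  (sliceRight W V).compl₂ (TensorProduct.comm ℂ V W).toLinearMap

variable {V W U V' W' : Type} [AddCommGroup V] [Module ℂ V] [AddCommGroup W] [Module ℂ W]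
  [AddCommGroup U] [Module ℂ U] [AddCommGroup V'] [Module ℂ V'] [AddCommGroup W'] [Module ℂ W']

@[simp]
theorem sliceRight_tmul (g : W →ₗ[ℂ] ℂ) (v : V) (w : W) :
    sliceRight V W g (v ⊗ₜ w) = g w • v := rfl

@[simp]
theorem sliceLeft_tmul (f : V →ₗ[ℂ] ℂ) (v : V) (w : W) :
    sliceLeft V W f (v ⊗ₜ w) = f v • w := rfl

/-- Both sides are (f ⊗ g)(t); this is the source of the symmetry of the injective norm. -/
theorem apply_sliceRight_comm (f : V →ₗ[ℂ] ℂ) (g : W →ₗ[ℂ] ℂ) (t : V ⊗[ℂ] W) :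
    g (sliceRight W V f (TensorProduct.comm ℂ V W t)) = f (sliceRight V W g t) := by
  induction t with
  | zero => simp
  | tmul v w => simp [mul_comm]
  | add s t hs ht => simp only [map_add, hs, ht]

theorem sliceRight_map (f : V →ₗ[ℂ] V') (g : W →ₗ[ℂ] W') (ψ : W' →ₗ[ℂ] ℂ) (t : V ⊗[ℂ] W) :
    sliceRight V' W' ψ (TensorProduct.map f g t) = f (sliceRight V W (ψ ∘ₗ g) t) := by
  induction t with
  | zero => simp
  | tmul v w => simp
  | add s t hs ht => simp only [map_add, hs, ht]

theorem sliceRight_sliceLeft_assoc (f : V →ₗ[ℂ] ℂ) (h : U →ₗ[ℂ] ℂ) (t : (V ⊗[ℂ] W) ⊗[ℂ] U) :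
    sliceRight W U h (sliceLeft V (W ⊗[ℂ] U) f (TensorProduct.assoc ℂ V W U t)) =
      sliceLeft V W f (sliceRight (V ⊗[ℂ] W) U h t) := by
  induction t with
  | zero => simp
  | tmul s u =>
    induction s with
    | zero => simp
    | tmul v w => simp [smul_smul, mul_comm]
    | add s t hs ht => simp only [TensorProduct.add_tmul, map_add, hs, ht]
  | add s t hs ht => simp only [map_add, hs, ht]

theorem sliceRight_eval_apply (v : V) (w : W) (t : (V →ₗ[ℂ] ℂ) ⊗[ℂ] (W →ₗ[ℂ] ℂ)) :
    sliceRight (V →ₗ[ℂ] ℂ) (W →ₗ[ℂ] ℂ) (Module.Dual.eval ℂ W w) t v =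
      TensorProduct.dualDistrib ℂ V W t (v ⊗ₜ w) := by
  induction t with
  | zero => simp
  | tmul f g =>
    simp [mul_comm]
  | add s t hs ht => simp only [map_add, LinearMap.add_apply, hs, ht]

/-! ### The injective norm through slice maps -/

variable [FiniteDimensional ℂ V] [FiniteDimensional ℂ W] [FiniteDimensional ℂ U]
  [FiniteDimensional ℂ V'] [FiniteDimensional ℂ W']
  {E : OperatorSpaceStructure V} {F : OperatorSpaceStructure W} {G : OperatorSpaceStructure U}
  {E' : OperatorSpaceStructure V'} {F' : OperatorSpaceStructure W'}
  {ι κ : Type} [Fintype ι] [Fintype κ]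

/-- The operator space structure of the completely injective tensor product. -/
noncomputable def inj (E : OperatorSpaceStructure V) (F : OperatorSpaceStructure W) :
    OperatorSpaceStructure (V ⊗[ℂ] W) := FdOS.injOSS ⟨V, E⟩ ⟨W, F⟩

/-- The operator space structure of the completely projective tensor product. -/
noncomputable def proj (E : OperatorSpaceStructure V) (F : OperatorSpaceStructure W) :
    OperatorSpaceStructure (V ⊗[ℂ] W) := FdOS.projOSS ⟨V, E⟩ ⟨W, F⟩

theorem injEquiv_eq : (FdOS.injEquiv ⟨V, E⟩ ⟨W, F⟩).toLinearMap = (sliceRight V W).flip :=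
  TensorProduct.ext' fun _ _ => rfl

theorem projEquiv_eq :
    (FdOS.projEquiv ⟨V, E⟩ ⟨W, F⟩).toLinearMap = (TensorProduct.dualDistrib ℂ V W).flip :=
  TensorProduct.ext' fun _ _ => TensorProduct.ext' fun _ _ => rfl

theorem mnorm_inj (u : Matrix ι ι (V ⊗[ℂ] W)) :
    (inj E F).mnorm u = (F.dual.cb E).mnorm (u.map (sliceRight V W).flip) := by
  rw [← injEquiv_eq (E := E) (F := F)]
  rfl

theorem mnorm_proj (u : Matrix ι ι (V ⊗[ℂ] W)) :
    (proj E F).mnorm u =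
      (inj E.dual F.dual).dual.mnorm (u.map (TensorProduct.dualDistrib ℂ V W).flip) := by
  rw [← projEquiv_eq (E := E) (F := F)]
  rfl

/-- Together with the converse `mnorm_inj_le`, this replaces the definition of the injective norm in
the coherence proofs. -/
theorem isJointlyCC_sliceRight : IsJointlyCC F.dual (inj E F) E (sliceRight V W) :=
  (isJointlyCC_iff_isCC.2 fun _ u => (mnorm_inj u).ge :
    IsJointlyCC (inj E F) F.dual E (sliceRight V W).flip).flip

theorem mnorm_inj_le (u : Matrix ι ι (V ⊗[ℂ] W)) {C : ℝ} (hC : 0 ≤ C)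
    (h : ∀ (k : ℕ) (g : Matrix (Fin k) (Fin k) (W →ₗ[ℂ] ℂ)),
      E.mnorm (amp (sliceRight V W) g u) ≤ F.dual.mnorm g * C) : (inj E F).mnorm u ≤ C := by
  rw [mnorm_inj]
  refine mnorm_cb_le _ _ _ hC fun k g => ?_
  rw [mul_comm]
  refine le_trans (le_of_eq ?_) (h k g)
  exact E.mnorm_amp_flip (sliceRight V W) g u

/-- The bijection interchanging the first two factors of a triple product. -/
def prodLeftComm (α β γ : Type) : α × (β × γ) ≃ β × (α × γ) where
  toFun p := (p.2.1, (p.1, p.2.2))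
  invFun p := (p.2.1, (p.1, p.2.2))
  left_inv _ := rfl
  right_inv _ := rfl

/-- The slice on the other side is normed by matrices g over W*. Applying g to the slice by f gives
(f ⊗ g)(u), which is also f applied to the slice of u by g, and that is bounded by ‖f‖‖g‖‖u‖. -/
theorem isCC_inj_comm : IsCC (inj E F) (inj F E) (TensorProduct.comm ℂ V W).toLinearMap := by
  intro n u
  have hu := (inj E F).mnorm_nonneg u
  refine mnorm_inj_le _ hu fun k f => F.mnorm_le_of_dual _ (mul_nonneg (mnorm_nonneg _ _) hu)
    fun l g => ?_
  have h1 := isJointlyCC_id.mnorm_le (E := E.dual) (F := E) (G := complex) f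
    (amp (sliceRight V W) g u)
  have h2 := isJointlyCC_sliceRight.mnorm_le (E := F.dual) (F := inj E F) (G := E) g u
  calc _ = complex.mnorm (amp LinearMap.id f (amp (sliceRight V W) g u)) := by
        rw [← complex.mnorm_reindex (prodLeftComm (Fin l) (Fin k) (Fin n))]
        congr 1
        ext p q
        exact apply_sliceRight_comm _ _ _
    _ ≤ E.dual.mnorm f * (F.dual.mnorm g * (inj E F).mnorm u) :=
        h1.trans (mul_le_mul_of_nonneg_left h2 (mnorm_nonneg _ _))
    _ = _ := mul_left_comm _ _ _

theorem isJointlyCC_sliceLeft : IsJointlyCC E.dual (inj E F) F (sliceLeft V W) := fun k n f u =>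
  (isJointlyCC_sliceRight k n f (u.map (TensorProduct.comm ℂ V W).toLinearMap)).trans
    (mul_le_mul_of_nonneg_left (isCC_inj_comm n u) (mnorm_nonneg _ _))

theorem mnorm_inj_le' (u : Matrix ι ι (V ⊗[ℂ] W)) {C : ℝ} (hC : 0 ≤ C)
    (h : ∀ (k : ℕ) (f : Matrix (Fin k) (Fin k) (V →ₗ[ℂ] ℂ)),
      F.mnorm (amp (sliceLeft V W) f u) ≤ E.dual.mnorm f * C) : (inj E F).mnorm u ≤ C := by
  have h1 := (isCC_inj_comm (E := F) (F := E)).mnorm_le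
    (u.map (TensorProduct.comm ℂ V W).toLinearMap)
  have h2 : (u.map (TensorProduct.comm ℂ V W).toLinearMap).map
      (TensorProduct.comm ℂ W V).toLinearMap = u := by
    ext p q
    simp
  rw [h2] at h1
  exact h1.trans (mnorm_inj_le _ hC h)

theorem isCC_inj_map {f : V →ₗ[ℂ] V'} {g : W →ₗ[ℂ] W'} (hf : IsCC E E' f) (hg : IsCC F F' g) :
    IsCC (inj E F) (inj E' F') (TensorProduct.map f g) := by
  intro n u
  refine mnorm_inj_le _ (mnorm_nonneg _ _) fun k ψ => ?_
  have h1 : amp (sliceRight V' W') ψ (u.map (TensorProduct.map f g)) =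
      (amp (sliceRight V W) (ψ.map (LinearMap.lcomp ℂ ℂ g)) u).map f := by
    ext p q
    exact sliceRight_map _ _ _ _
  rw [h1]
  refine (hf.mnorm_le _).trans
    ((isJointlyCC_sliceRight.mnorm_le (E := F.dual) (F := inj E F) _ _).trans ?_)
  exact mul_le_mul_of_nonneg_right (isCC_lcomp hg _ ψ) (mnorm_nonneg _ _)

/-- Slice off the outer factors V and U. The resulting matrix over W does not depend on the
bracketing, and bounding it needs slices on both sides, hence the symmetry proved above. -/
theorem isCC_inj_assoc :
    IsCC (inj (inj E F) G) (inj E (inj F G)) (TensorProduct.assoc ℂ V W U).toLinearMap := by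
  intro n u
  have hu := (inj (inj E F) G).mnorm_nonneg u
  refine mnorm_inj_le' _ hu fun k f => mnorm_inj_le _ (mul_nonneg (mnorm_nonneg _ _) hu)
    fun l h => ?_
  have h1 := isJointlyCC_sliceLeft.mnorm_le (E := E.dual) (F := inj E F) (G := F) f
    (amp (sliceRight (V ⊗[ℂ] W) U) h u)
  have h2 := isJointlyCC_sliceRight.mnorm_le (E := G.dual) (F := inj (inj E F) G)
    (G := inj E F) h u
  calc _ = F.mnorm (amp (sliceLeft V W) f (amp (sliceRight (V ⊗[ℂ] W) U) h u)) := by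
        rw [← F.mnorm_reindex (prodLeftComm (Fin l) (Fin k) (Fin n))]
        congr 1
        ext p q
        exact sliceRight_sliceLeft_assoc _ _ _
    _ ≤ E.dual.mnorm f * (G.dual.mnorm h * (inj (inj E F) G).mnorm u) :=
        h1.trans (mul_le_mul_of_nonneg_left h2 (mnorm_nonneg _ _))
    _ = _ := mul_left_comm _ _ _

/-- The unitor is the slice by the identity functional of ℂ, which is completely contractive. -/
theorem isCC_inj_rid : IsCC (inj E complex) E (TensorProduct.rid ℂ V).toLinearMap := by
  intro n u
  have h1 := isJointlyCC_sliceRight.mnorm_le (E := complex.dual) (F := inj E complex) (G := E)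
    (Matrix.of fun _ _ : Unit => LinearMap.id) u
  have h2 : complex.dual.mnorm (Matrix.of fun _ _ : Unit => (LinearMap.id : ℂ →ₗ[ℂ] ℂ)) ≤ 1 :=
    mnorm_cb_le _ _ _ zero_le_one fun m x => by
      rw [one_mul, ← complex.mnorm_reindex (Equiv.punitProd (Fin m)) x]
      rfl
  have h3 : E.mnorm (u.map (TensorProduct.rid ℂ V).toLinearMap) =
      E.mnorm (amp (sliceRight V ℂ) (Matrix.of fun _ _ : Unit => LinearMap.id) u) := by
    rw [← E.mnorm_reindex (Equiv.punitProd (Fin n))]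
    congr 1
    ext p q
    simp [sliceRight]
  rw [h3]
  exact h1.trans (mul_le_of_le_one_left (mnorm_nonneg _ _) h2)

theorem mnorm_one_le : complex.mnorm (Matrix.of fun _ _ : Unit => (1 : ℂ)) ≤ 1 := by
  have h : (Matrix.of fun _ _ : Unit => (1 : ℂ)) = (1 : Matrix Unit Unit ℂ) := by
    ext
    simp
  rw [h, complex_mnorm]
  exact norm_le_one_of_conjTranspose_mul_self (by simp)

/-- The slice of x ⊗ 1 by g is g(1)x, so scalar multiplication and the evaluation of g at 1 give the
bound. -/
theorem isCC_inj_rid_symm : IsCC E (inj E complex) (TensorProduct.rid ℂ V).symm.toLinearMap := by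
  intro n x
  refine mnorm_inj_le _ (mnorm_nonneg _ _) fun k g => ?_
  have h1 : amp (sliceRight V ℂ) g (x.map (TensorProduct.rid ℂ V).symm.toLinearMap) =
      amp (LinearMap.lsmul ℂ V) (g.map (Module.Dual.eval ℂ ℂ 1)) x := by
    ext p q
    simp
  rw [h1]
  refine (isJointlyCC_lsmul.mnorm_le (E := complex) _ x).trans
    (mul_le_mul_of_nonneg_right ?_ (mnorm_nonneg _ _))
  have h2 := isJointlyCC_id.mnorm_le (E := complex.dual) (F := complex) (G := complex) g
    (Matrix.of fun _ _ : Unit => (1 : ℂ))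
  have h3 : complex.mnorm (g.map (Module.Dual.eval ℂ ℂ 1)) =
      complex.mnorm (amp LinearMap.id g (Matrix.of fun _ _ : Unit => (1 : ℂ))) := by
    rw [← complex.mnorm_reindex (Equiv.prodPUnit (Fin k))]
    rfl
  rw [h3]
  exact h2.trans (mul_le_of_le_one_right (mnorm_nonneg _ _) mnorm_one_le)

/-! ### The universal property of the completely projective tensor product -/

theorem isJointlyCC_dualDistrib :
    IsJointlyCC (inj E.dual F.dual) (proj E F) complex (TensorProduct.dualDistrib ℂ V W) :=
  (isJointlyCC_iff_isCC.2 fun _ u => (mnorm_proj u).ge :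
    IsJointlyCC (proj E F) (inj E.dual F.dual) complex
      (TensorProduct.dualDistrib ℂ V W).flip).flip

/-- Pairing x ⊗ y with w ∈ V* ⊗ W* amounts to slicing w by y, seen in W**, and evaluating the result
at x. Each operation is contractive. -/
theorem isJointlyCC_mk : IsJointlyCC E F (proj E F) (TensorProduct.mk ℂ V W) := by
  intro m n x y
  rw [mnorm_proj]
  refine mnorm_cb_le _ _ _ (mul_nonneg (mnorm_nonneg _ _) (mnorm_nonneg _ _)) fun k w => ?_
  have h1 := isJointlyCC_id.mnorm_le (E := E.dual) (F := E) (G := complex)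
    (amp (sliceRight (V →ₗ[ℂ] ℂ) (W →ₗ[ℂ] ℂ)) (y.map (Module.Dual.eval ℂ W)) w) x
  have h2 := isJointlyCC_sliceRight.mnorm_le (E := F.dual.dual) (F := inj E.dual F.dual)
    (G := E.dual) (y.map (Module.Dual.eval ℂ W)) w
  have h3 := isCC_eval.mnorm_le (E := F) y
  let e : (Fin m × Fin n) × Fin k ≃ (Fin n × Fin k) × Fin m :=
    (Equiv.prodAssoc _ _ _).trans (Equiv.prodComm _ _)
  calc _ = complex.mnorm (amp LinearMap.id
        (amp (sliceRight (V →ₗ[ℂ] ℂ) (W →ₗ[ℂ] ℂ)) (y.map (Module.Dual.eval ℂ W)) w) x) := by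
        rw [← complex.mnorm_reindex e]
        congr 1
        ext p q
        exact (sliceRight_eval_apply _ _ _).symm
    _ ≤ F.mnorm y * (inj E.dual F.dual).mnorm w * E.mnorm x :=
        h1.trans (mul_le_mul_of_nonneg_right
          (h2.trans (mul_le_mul_of_nonneg_right h3 (mnorm_nonneg _ _))) (mnorm_nonneg _ _))
    _ = _ := by ring

/-- The transpose of the lift of b, with values read in V* ⊗ W*. Its slices run over W**, where
reflexivity replaces γ by a matrix y over W of no larger norm; such a slice evaluated at x is φ(b(x,
y)). -/
theorem isCC_dualDistribEquiv_symm {b : V →ₗ[ℂ] W →ₗ[ℂ] U} (hb : IsJointlyCC E F G b) :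
    IsCC G.dual (inj E.dual F.dual) ((TensorProduct.dualDistribEquiv ℂ V W).symm.toLinearMap ∘ₗ
      LinearMap.lcomp ℂ ℂ (TensorProduct.lift b)) := by
  intro k φ
  refine mnorm_inj_le _ (mnorm_nonneg _ _) fun l γ => mnorm_cb_le _ _ _
    (mul_nonneg (mnorm_nonneg _ _) (mnorm_nonneg _ _)) fun m x => ?_
  set y := γ.map (Module.evalEquiv ℂ W).symm.toLinearMap with hy
  have h1 := isJointlyCC_id.mnorm_le (E := G.dual) (F := G) (G := complex) φ (amp b x y)
  have h2 : F.mnorm y ≤ F.dual.dual.mnorm γ := isCC_evalEquiv_symm.mnorm_le γ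
  let e : (Fin l × Fin k) × Fin m ≃ Fin k × (Fin m × Fin l) :=
    (((Equiv.prodComm _ _).prodCongr (Equiv.refl _)).trans (Equiv.prodAssoc _ _ _)).trans
      ((Equiv.refl _).prodCongr (Equiv.prodComm _ _))
  calc _ = complex.mnorm (amp LinearMap.id φ (amp b x y)) := by
        rw [← complex.mnorm_reindex e]
        congr 1
        ext p q
        have h3 := sliceRight_eval_apply (x p.2 q.2) (y p.1.1 q.1.1)
          ((TensorProduct.dualDistribEquiv ℂ V W).symm (φ p.1.2 q.1.2 ∘ₗ TensorProduct.lift b))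
        have h4 : Module.Dual.eval ℂ W (y p.1.1 q.1.1) = γ p.1.1 q.1.1 :=
          (Module.evalEquiv ℂ W).apply_symm_apply _
        rw [h4] at h3
        refine h3.trans ?_
        exact congrArg (fun f : V ⊗[ℂ] W →ₗ[ℂ] ℂ => f (x p.2 q.2 ⊗ₜ y p.1.1 q.1.1))
          ((TensorProduct.dualDistribEquiv ℂ V W).apply_symm_apply _)
    _ ≤ G.dual.mnorm φ * (E.mnorm x * F.dual.dual.mnorm γ) :=
        h1.trans (mul_le_mul_of_nonneg_left ((hb.mnorm_le x y).trans
          (mul_le_mul_of_nonneg_left h2 (mnorm_nonneg _ _))) (mnorm_nonneg _ _))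
    _ = _ := by ring

/-- By the transposition criterion it is enough to bound the transpose, and the projective norm is
by definition dual to the injective norm on V* ⊗ W*. -/
theorem isCC_lift {b : V →ₗ[ℂ] W →ₗ[ℂ] U} (hb : IsJointlyCC E F G b) :
    IsCC (proj E F) G (TensorProduct.lift b) := by
  refine isCC_of_transpose fun k n φ t => ?_
  have h1 := isJointlyCC_dualDistrib.mnorm_le (E := inj E.dual F.dual) (F := proj E F)
    (G := complex) (φ.map ((TensorProduct.dualDistribEquiv ℂ V W).symm.toLinearMap ∘ₗ
      LinearMap.lcomp ℂ ℂ (TensorProduct.lift b))) t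
  refine le_trans (le_of_eq ?_) (h1.trans (mul_le_mul_of_nonneg_right
    (isCC_dualDistribEquiv_symm hb k φ) (mnorm_nonneg _ _)))
  congr 1
  ext p q
  have h2 := (TensorProduct.dualDistribEquiv ℂ V W).apply_symm_apply
    (φ p.1 q.1 ∘ₗ TensorProduct.lift b)
  exact (LinearMap.congr_fun h2 _).symm

/-- The universal property; the closed structure and, with `isJointlyCC_mk`, the coherence maps need
nothing else about the projective norm. -/
theorem isCC_proj_iff {f : V ⊗[ℂ] W →ₗ[ℂ] U} :
    IsCC (proj E F) G f ↔ IsJointlyCC E F G (TensorProduct.curry f) := by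
  refine ⟨fun hf => isJointlyCC_mk.compr₂ hf, fun hf => ?_⟩
  have h : TensorProduct.lift (TensorProduct.curry f) = f := TensorProduct.ext' fun _ _ => rfl
  exact h ▸ isCC_lift hf

end Tensor
end OperatorSpaceStructure

/-! ### Coherence maps of the projective tensor product -/

namespace OperatorSpaceStructure

section Tensor

variable {V W U V' W' : Type} [AddCommGroup V] [Module ℂ V] [AddCommGroup W] [Module ℂ W]
  [AddCommGroup U] [Module ℂ U] [AddCommGroup V'] [Module ℂ V'] [AddCommGroup W'] [Module ℂ W']
  [FiniteDimensional ℂ V] [FiniteDimensional ℂ W] [FiniteDimensional ℂ U]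
  [FiniteDimensional ℂ V'] [FiniteDimensional ℂ W']
  {E : OperatorSpaceStructure V} {F : OperatorSpaceStructure W} {G : OperatorSpaceStructure U}
  {E' : OperatorSpaceStructure V'} {F' : OperatorSpaceStructure W'}

theorem isCC_proj_comm : IsCC (proj E F) (proj F E) (TensorProduct.comm ℂ V W).toLinearMap :=
  isCC_proj_iff.2 isJointlyCC_mk.flip

theorem isCC_proj_map {f : V →ₗ[ℂ] V'} {g : W →ₗ[ℂ] W'} (hf : IsCC E E' f) (hg : IsCC F F' g) :
    IsCC (proj E F) (proj E' F') (TensorProduct.map f g) :=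
  isCC_proj_iff.2 (isJointlyCC_mk.compl₁₂ hf hg)

/-- Currying twice reduces the claim to the trilinear map (x, y, z) ↦ x ⊗ (y ⊗ z). -/
theorem isCC_proj_assoc :
    IsCC (proj (proj E F) G) (proj E (proj F G)) (TensorProduct.assoc ℂ V W U).toLinearMap := by
  refine isCC_proj_iff.2 (isJointlyCC_iff_isCC.2 (isCC_proj_iff.2 fun m n x y =>
    mnorm_cb_le _ _ _ (mul_nonneg (mnorm_nonneg _ _) (mnorm_nonneg _ _)) fun k z => ?_))
  have h1 := isJointlyCC_mk.mnorm_le (E := E) (F := proj F G) x (amp (TensorProduct.mk ℂ W U) y z)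
  have h2 := isJointlyCC_mk.mnorm_le (E := F) (F := G) y z
  calc _ = (proj E (proj F G)).mnorm
        (amp (TensorProduct.mk ℂ V (W ⊗[ℂ] U)) x (amp (TensorProduct.mk ℂ W U) y z)) := by
        rw [← (proj E (proj F G)).mnorm_reindex (Equiv.prodAssoc (Fin m) (Fin n) (Fin k))]
        rfl
    _ ≤ E.mnorm x * (F.mnorm y * G.mnorm z) :=
        h1.trans (mul_le_mul_of_nonneg_left h2 (mnorm_nonneg _ _))
    _ = _ := (mul_assoc _ _ _).symm

theorem isCC_proj_rid : IsCC (proj E complex) E (TensorProduct.rid ℂ V).toLinearMap :=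
  isCC_proj_iff.2 isJointlyCC_lsmul.flip

theorem isCC_proj_rid_symm :
    IsCC E (proj E complex) (TensorProduct.rid ℂ V).symm.toLinearMap := by
  intro n x
  have h := isJointlyCC_mk.mnorm_le (E := E) (F := complex) x (Matrix.of fun _ _ : Unit => (1 : ℂ))
  refine le_trans (le_of_eq ?_) (h.trans (mul_le_of_le_one_right (mnorm_nonneg _ _) mnorm_one_le))
  rw [← (proj E complex).mnorm_reindex (Equiv.prodPUnit (Fin n))]
  rfl

end Tensor

end OperatorSpaceStructure

/-! ### The two symmetric monoidal structures on the category -/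

namespace FdOS

open OperatorSpaceStructure

theorem isCC_iff {X Y : FdOS} {f : X →ₗ[ℂ] Y} :
    IsCC f ↔ OperatorSpaceStructure.IsCC X.oss Y.oss f := by
  simp only [IsCC, OperatorSpaceStructure.IsCC, mnorm_fin]

theorem isCC_comp {X Y Z : FdOS} {f : X →ₗ[ℂ] Y} {g : Y →ₗ[ℂ] Z} (hg : IsCC g) (hf : IsCC f) :
    IsCC (g ∘ₗ f) := fun n x => (hg n (x.map f)).trans (hf n x)

/-- A symmetric monoidal structure is determined by half of its coherence maps. -/
theorem IsSymmetricMonoidal.of_comm {ν : ∀ X Y : FdOS, OperatorSpaceStructure (X ⊗[ℂ] Y)}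
    (map_isCC : ∀ {X X' Y Y' : FdOS} (f : X ⟶ X') (g : Y ⟶ Y'),
      IsCC (X := tensorOf ν X Y) (Y := tensorOf ν X' Y') (TensorProduct.map f.lin g.lin))
    (assoc_isCC : ∀ X Y Z : FdOS,
      IsCC (X := tensorOf ν (tensorOf ν X Y) Z) (Y := tensorOf ν X (tensorOf ν Y Z))
        (TensorProduct.assoc ℂ X Y Z).toLinearMap)
    (rid_isCC : ∀ X : FdOS,
      IsCC (X := tensorOf ν X complex) (Y := X) (TensorProduct.rid ℂ X).toLinearMap)
    (rid_symm_isCC : ∀ X : FdOS,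
      IsCC (X := X) (Y := tensorOf ν X complex) (TensorProduct.rid ℂ X).symm.toLinearMap)
    (comm_isCC : ∀ X Y : FdOS,
      IsCC (X := tensorOf ν X Y) (Y := tensorOf ν Y X) (TensorProduct.comm ℂ X Y).toLinearMap) :
    IsSymmetricMonoidal ν where
  map_isCC := map_isCC
  assoc_isCC := assoc_isCC
  assoc_symm_isCC X Y Z := by
    -- The inverse associator as a composite of forward ones and symmetries: X(YZ) → (YZ)X → Y(ZX) →
    -- (ZX)Y → Z(XY) → (XY)Z.
    have h := isCC_comp (comm_isCC Z (tensorOf ν X Y)) (isCC_comp (assoc_isCC Z X Y)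
      (isCC_comp (comm_isCC Y (tensorOf ν Z X)) (isCC_comp (assoc_isCC Y Z X)
        (comm_isCC X (tensorOf ν Y Z)))))
    refine Eq.mp (congrArg (IsCC (X := tensorOf ν X (tensorOf ν Y Z))
      (Y := tensorOf ν (tensorOf ν X Y) Z)) ?_) h
    exact TensorProduct.ext (LinearMap.ext fun _ => TensorProduct.ext' fun _ _ => rfl)
  lid_isCC X := by
    have h := isCC_comp (rid_isCC X) (comm_isCC complex X)
    refine Eq.mp (congrArg (IsCC (X := tensorOf ν complex X) (Y := X)) ?_) h
    exact TensorProduct.ext' fun _ _ => rfl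
  lid_symm_isCC X := isCC_comp (comm_isCC X complex) (rid_symm_isCC X)
  rid_isCC := rid_isCC
  rid_symm_isCC := rid_symm_isCC
  comm_isCC := comm_isCC

theorem isSymmetricMonoidal_proj : IsSymmetricMonoidal projOSS :=
  .of_comm
    (fun f g => isCC_iff.2 (isCC_proj_map (isCC_iff.1 f.isCC) (isCC_iff.1 g.isCC)))
    (fun _ _ _ => isCC_iff.2 isCC_proj_assoc)
    (fun _ => isCC_iff.2 isCC_proj_rid)
    (fun _ => isCC_iff.2 isCC_proj_rid_symm)
    (fun _ _ => isCC_iff.2 isCC_proj_comm)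

theorem isSymmetricMonoidal_inj : IsSymmetricMonoidal injOSS :=
  .of_comm
    (fun f g => isCC_iff.2 (isCC_inj_map (isCC_iff.1 f.isCC) (isCC_iff.1 g.isCC)))
    (fun _ _ _ => isCC_iff.2 isCC_inj_assoc)
    (fun _ => isCC_iff.2 isCC_inj_rid)
    (fun _ => isCC_iff.2 isCC_inj_rid_symm)
    (fun _ _ => isCC_iff.2 isCC_inj_comm)

/-! ### Zero object, products and coproducts -/

theorem isZero_zero : IsZero zero where
  unique_to Y := ⟨⟨⟨⟨0, fun n x => by
    have : x.map (0 : zero →ₗ[ℂ] Y) = 0 := rfl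
    rw [this, map_zero]
    exact apply_nonneg _ _⟩⟩, fun f => hom_ext (LinearMap.ext fun (x : PUnit) => map_zero f.lin)⟩⟩
  unique_from Y := ⟨⟨⟨⟨0, fun n x => apply_nonneg (Y.oss.nrm n) x⟩⟩,
    fun f => hom_ext (LinearMap.ext fun _ => (rfl : PUnit.unit = PUnit.unit))⟩⟩

/-- The first projection of `X ⊕^∞ Y`. -/
noncomputable def linftyFst (X Y : FdOS) : linftySum X Y ⟶ X :=
  ⟨LinearMap.fst ℂ X Y, fun n x => le_max_left (X.oss.nrm n (x.map Prod.fst)) _⟩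

/-- The second projection of `X ⊕^∞ Y`. -/
noncomputable def linftySnd (X Y : FdOS) : linftySum X Y ⟶ Y :=
  ⟨LinearMap.snd ℂ X Y, fun n x => le_max_right _ (Y.oss.nrm n (x.map Prod.snd))⟩

/-- The morphism to `X ⊕^∞ Y` with given components. -/
noncomputable def linftyLift {X Y Z : FdOS} (f : Z ⟶ X) (g : Z ⟶ Y) : Z ⟶ linftySum X Y :=
  ⟨f.lin.prod g.lin, fun n z => max_le (f.isCC n z) (g.isCC n z)⟩

/-- `X ⊕^∞ Y` is a product of `X` and `Y`. -/
noncomputable def linftyIsLimit (X Y : FdOS) :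
    IsLimit (BinaryFan.mk (linftyFst X Y) (linftySnd X Y)) :=
  BinaryFan.isLimitMk (fun s => linftyLift s.fst s.snd) (fun _ => rfl) (fun _ => rfl)
    fun s m h₁ h₂ => by
      rw [← h₁, ← h₂]
      rfl

theorem mnorm_comap {V W : Type} [AddCommGroup V] [Module ℂ V] [AddCommGroup W] [Module ℂ W]
    (e : V ≃ₗ[ℂ] W) (E : OperatorSpaceStructure W) {ι : Type} [Fintype ι] (x : Matrix ι ι V) :
    (E.comap e).mnorm x = E.mnorm (x.map e) := rfl

/-- The sum carries the norm of a dual space, so its pairing with X* ⊕^∞ Y* is contractive.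
Conversely, `isCC_loneSum` tests maps into the sum by this pairing. -/
theorem isJointlyCC_loneEquiv (X Y : FdOS) :
    IsJointlyCC (loneSum X Y).oss (X.oss.dual.linfty Y.oss.dual) OperatorSpaceStructure.complex
      (loneEquiv X Y).toLinearMap :=
  isJointlyCC_iff_isCC.2 fun _ _ => le_rfl

theorem isCC_loneSum {X Y Z : FdOS} {f : Z →ₗ[ℂ] X × Y}
    (hf : IsJointlyCC Z.oss (X.oss.dual.linfty Y.oss.dual) OperatorSpaceStructure.complex
      ((loneEquiv X Y).toLinearMap ∘ₗ f)) : IsCC (X := Z) (Y := loneSum X Y) f :=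
  isCC_iff.2 fun n x => (mnorm_comap _ _ _).trans_le (isJointlyCC_iff_isCC.1 hf n x)

/-- The first injection of `X ⊕^1 Y`. -/
noncomputable def loneInl (X Y : FdOS) : X ⟶ loneSum X Y :=
  ⟨LinearMap.inl ℂ X Y, isCC_loneSum fun m n x w => by
    have h := (isJointlyCC_id (E := X.oss) (F := OperatorSpaceStructure.complex)).flip m n x
      (w.map Prod.fst)
    refine le_trans (le_of_eq ?_) (h.trans (mul_le_mul_of_nonneg_left
      (le_max_left _ (Y.oss.dual.mnorm (w.map Prod.snd))) (mnorm_nonneg _ _)))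
    congr 1
    ext p q
    change (w p.2 q.2).1 (x p.1 q.1) + (w p.2 q.2).2 0 = (w p.2 q.2).1 (x p.1 q.1)
    rw [map_zero, add_zero]⟩

/-- The second injection of `X ⊕^1 Y`. -/
noncomputable def loneInr (X Y : FdOS) : Y ⟶ loneSum X Y :=
  ⟨LinearMap.inr ℂ X Y, isCC_loneSum fun m n y w => by
    have h := (isJointlyCC_id (E := Y.oss) (F := OperatorSpaceStructure.complex)).flip m n y
      (w.map Prod.snd)
    refine le_trans (le_of_eq ?_) (h.trans (mul_le_mul_of_nonneg_left
      (le_max_right (X.oss.dual.mnorm (w.map Prod.fst)) _) (mnorm_nonneg _ _)))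
    congr 1
    ext p q
    change (w p.2 q.2).1 0 + (w p.2 q.2).2 (y p.1 q.1) = (w p.2 q.2).2 (y p.1 q.1)
    rw [map_zero, zero_add]⟩

/-- The morphism from `X ⊕^1 Y` with given components. -/
noncomputable def loneDesc {X Y Z : FdOS} (f : X ⟶ Z) (g : Y ⟶ Z) : loneSum X Y ⟶ Z :=
  -- Transposed, the copairing sends φ to (φ ∘ f, φ ∘ g) in X* ⊕^∞ Y*, whose norm is the larger of
  -- two numbers bounded by ‖φ‖.
  ⟨f.lin.coprod g.lin, isCC_iff.2 (isCC_of_transpose fun k n φ t => by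
    have hf := isCC_lcomp (G := OperatorSpaceStructure.complex) (isCC_iff.1 f.isCC) k φ
    have hg := isCC_lcomp (G := OperatorSpaceStructure.complex) (isCC_iff.1 g.isCC) k φ
    have h := (isJointlyCC_loneEquiv X Y).flip.mnorm_le
      (φ.map ((LinearMap.lcomp ℂ ℂ f.lin).prod (LinearMap.lcomp ℂ ℂ g.lin))) t
    refine le_trans (le_of_eq ?_) (h.trans (mul_le_mul_of_nonneg_right
      (max_le hf hg) (mnorm_nonneg _ _)))
    congr 1
    ext p q
    exact map_add (φ p.1 q.1) _ _)⟩

/-- `X ⊕^1 Y` is a coproduct of `X` and `Y`. -/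
noncomputable def loneIsColimit (X Y : FdOS) :
    IsColimit (BinaryCofan.mk (loneInl X Y) (loneInr X Y)) :=
  BinaryCofan.isColimitMk (fun s => loneDesc s.inl s.inr)
    (fun s => hom_ext (LinearMap.coprod_inl s.inl.lin s.inr.lin))
    (fun s => hom_ext (LinearMap.coprod_inr s.inl.lin s.inr.lin))
    fun s m h₁ h₂ => by
      rw [← h₁, ← h₂]
      exact hom_ext (LinearMap.ext fun p : X × Y =>
        (congrArg m.lin (Prod.fst_add_snd p).symm).trans (map_add m.lin _ _))

theorem hasFiniteProducts : HasFiniteProducts FdOS := by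
  have : HasTerminal FdOS := isZero_zero.isTerminal.hasTerminal
  have (X Y : FdOS) : HasLimit (pair X Y) := ⟨⟨_, linftyIsLimit X Y⟩⟩
  have : HasBinaryProducts FdOS := hasBinaryProducts_of_hasLimit_pair FdOS
  exact hasFiniteProducts_of_has_binary_and_terminal

theorem hasFiniteCoproducts : HasFiniteCoproducts FdOS := by
  have : HasInitial FdOS := isZero_zero.isInitial.hasInitial
  have (X Y : FdOS) : HasColimit (pair X Y) := ⟨⟨_, loneIsColimit X Y⟩⟩
  have : HasBinaryCoproducts FdOS := hasBinaryCoproducts_of_hasColimit_pair FdOS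
  exact hasFiniteCoproducts_of_has_binary_and_initial

end FdOS

namespace FdOS

open OperatorSpaceStructure

/-! ### The closed structure -/

section Closed

noncomputable local instance projMonoidal : MonoidalCategory FdOS :=
  isSymmetricMonoidal_proj.monoidalCategory

noncomputable local instance projSymmetric : SymmetricCategory FdOS :=
  isSymmetricMonoidal_proj.symmetricCategory

/-- The evaluation morphism `X ⊗ CB(X, Y) ⟶ Y`. -/
noncomputable def evalHom (X Y : FdOS) : X ⊗ CB X Y ⟶ Y :=
  ⟨evalMap X Y, isCC_iff.2 (isCC_lift isJointlyCC_id.flip)⟩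

/-- Currying of morphisms. -/
noncomputable def curryHom {X Y Z : FdOS} (f : X ⊗ Z ⟶ Y) : Z ⟶ CB X Y :=
  ⟨(TensorProduct.curry (M := X) (N := Z) f.lin).flip,
    isCC_iff.2 (isJointlyCC_iff_isCC.1 (isCC_proj_iff.1 (isCC_iff.1 f.isCC)).flip)⟩

/-- The spaces `CB(X, Y)` are internal homs for the completely projective tensor product. -/
noncomputable def internalHom : InternalHom FdOS CB where
  ev := evalHom
  existsUnique_curry {A B Z} f := by
    refine ⟨curryHom f, hom_ext (TensorProduct.ext' (M := A) (N := Z) fun a z => rfl),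
      fun g hg => hom_ext (LinearMap.ext fun z => LinearMap.ext fun (a : A) => ?_)⟩
    rw [← hg]
    rfl

noncomputable local instance projClosed : MonoidalClosed FdOS := internalHom.monoidalClosed

/-- The closed structure is produced by an abstract adjunction. Identifying its counit with concrete
evaluation is what makes currying, the functoriality of the hom and `MonoidalClosed.pre` computable
on elements. -/
theorem ihom_ev_app (X Y : FdOS) : (ihom.ev X).app Y = evalHom X Y := by
  have h : (ihom.ev X).app Y = X ◁ 𝟙 (CB X Y) ≫ evalHom X Y :=
    Adjunction.adjunctionOfEquivRight_counit_app _ _ _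
  rw [h, MonoidalCategory.whiskerLeft_id, Category.id_comp]

theorem curry_lin_apply {X Y Z : FdOS} (f : X ⊗ Z ⟶ Y) (z : Z) (x : X) :
    DFunLike.coe (F := X →ₗ[ℂ] Y) ((MonoidalClosed.curry f).lin z) x = f.lin (x ⊗ₜ[ℂ] z) := by
  have h := MonoidalClosed.whiskerLeft_curry_ihom_ev_app X Y f
  rw [ihom_ev_app] at h
  exact LinearMap.congr_fun (congrArg Hom.lin h) (x ⊗ₜ[ℂ] z)

theorem ihom_map_lin_apply (X : FdOS) {Y Y' : FdOS} (g : Y ⟶ Y') (φ : X →ₗ[ℂ] Y) (x : X) :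
    DFunLike.coe (F := X →ₗ[ℂ] Y') (((ihom X).map g).lin φ) x = g.lin (φ x) := by
  have h := (ihom.ev X).naturality g
  rw [ihom_ev_app, ihom_ev_app] at h
  exact LinearMap.congr_fun (congrArg Hom.lin h) (x ⊗ₜ[ℂ] φ)

theorem pre_lin_apply {X X' : FdOS} (f : X' ⟶ X) (Y : FdOS) (φ : X →ₗ[ℂ] Y) (x : X') :
    DFunLike.coe (F := X' →ₗ[ℂ] Y) (((MonoidalClosed.pre f).app Y).lin φ) x = φ (f.lin x) := by
  have h := MonoidalClosed.id_tensor_pre_app_comp_ev f Y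
  rw [ihom_ev_app, ihom_ev_app] at h
  exact LinearMap.congr_fun (congrArg Hom.lin h) (x ⊗ₜ[ℂ] φ)

/-- The isomorphism of a finite-dimensional operator space with its bidual. -/
noncomputable def bidualIso (X : FdOS) : X ≅ CB (CB X complex) complex :=
  isoMk (Y := CB (CB X complex) complex) (Module.evalEquiv ℂ X) (isCC_iff.2 isCC_eval)
    (isCC_iff.2 isCC_evalEquiv_symm)

/-- The canonical morphism is thus the completely isometric embedding into the bidual, which is onto
in finite dimension. -/
theorem toBidual_eq (X : FdOS) : toBidual complex X = (bidualIso X).hom :=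
  hom_ext (LinearMap.ext fun x => LinearMap.ext fun (φ : X →ₗ[ℂ] ℂ) => by
    refine (curry_lin_apply (X := CB X complex) (Y := complex) _ x φ).trans ?_
    rw [ihom_ev_app]
    rfl)

theorem isMALLModel : IsMALLModel FdOS.complex where
  isIso_toBidual X := by
    rw [toBidual_eq]
    exact (bidualIso X).isIso_hom
  hasFiniteProducts := hasFiniteProducts
  hasFiniteCoproducts := hasFiniteCoproducts

/-! ### Par -/

theorem isCC_injEquiv (X Y : FdOS) :
    IsCC (X := injTensor X Y) (Y := CB (dual Y) X) (injEquiv X Y).toLinearMap :=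
  fun _ _ => le_rfl

theorem isCC_injEquiv_symm (X Y : FdOS) :
    IsCC (X := CB (dual Y) X) (Y := injTensor X Y) (injEquiv X Y).symm.toLinearMap :=
  isCC_iff.2 fun n φ => by
    refine le_of_eq ((mnorm_comap (injEquiv X Y) _ _).trans ?_)
    exact congrArg _ (Matrix.ext fun p q => (injEquiv X Y).apply_symm_apply (φ p q))

/-- The symmetry of the completely injective tensor product. -/
noncomputable def injComm (X Y : FdOS) : injTensor X Y ≅ injTensor Y X :=
  isoMk (X := injTensor X Y) (Y := injTensor Y X) (TensorProduct.comm ℂ X Y)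
    (isSymmetricMonoidal_inj.comm_isCC X Y) (isSymmetricMonoidal_inj.comm_isCC Y X)

/-- The isomorphism between the completely injective tensor product and `CB(Y*, X)`. -/
noncomputable def injIso (X Y : FdOS) : injTensor X Y ≅ CB (dual Y) X :=
  isoMk (X := injTensor X Y) (Y := CB (dual Y) X) (injEquiv X Y) (isCC_injEquiv X Y)
    (isCC_injEquiv_symm X Y)

/-- The isomorphism between the completely injective tensor product and the par. -/
noncomputable def parIso (X Y : FdOS) : injTensor X Y ≅ par complex X Y :=
  injComm X Y ≪≫ injIso Y X

theorem parIso_hom_lin (X Y : FdOS) : (parIso X Y).hom.lin = toHomDual X Y := rfl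

theorem parMap_lin_apply {X X' Y Y' : FdOS} (f : X ⟶ X') (g : Y ⟶ Y')
    (T : (X →ₗ[ℂ] ℂ) →ₗ[ℂ] Y) (φ : X' →ₗ[ℂ] ℂ) :
    DFunLike.coe (F := (X' →ₗ[ℂ] ℂ) →ₗ[ℂ] Y') ((parMap complex f g).lin T) φ =
      g.lin (T (φ ∘ₗ f.lin)) := by
  have h1 := pre_lin_apply ((MonoidalClosed.pre f).app complex) Y T φ
  have h2 : ((MonoidalClosed.pre f).app complex).lin φ = φ ∘ₗ f.lin :=
    LinearMap.ext fun v : X => pre_lin_apply f complex φ v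
  exact (ihom_map_lin_apply (CB X' complex) g
    (((MonoidalClosed.pre ((MonoidalClosed.pre f).app complex)).app Y).lin T) φ).trans
    (congrArg g.lin (h1.trans (congrArg T h2)))

theorem map_toHomDual {X X' Y Y' : FdOS} (f : X ⟶ X') (g : Y ⟶ Y') (x : X) (y : Y)
    (φ : X' →ₗ[ℂ] ℂ) : toHomDual X' Y' (f.lin x ⊗ₜ g.lin y) φ =
      g.lin (toHomDual X Y (x ⊗ₜ y) (φ ∘ₗ f.lin)) :=
  (map_smul g.lin (φ (f.lin x)) y).symm

theorem parIso_naturality {X X' Y Y' : FdOS} (f : X ⟶ X') (g : Y ⟶ Y') :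
    isSymmetricMonoidal_inj.tensorMap f g ≫ (parIso X' Y').hom =
      (parIso X Y).hom ≫ parMap complex f g := by
  have h : toHomDual X' Y' ∘ₗ TensorProduct.map f.lin g.lin =
      (parMap complex f g).lin ∘ₗ toHomDual X Y :=
    TensorProduct.ext' fun x y => LinearMap.ext fun (φ : X' →ₗ[ℂ] ℂ) =>
      (map_toHomDual f g x y φ).trans
        (parMap_lin_apply f g (toHomDual X Y (x ⊗ₜ y)) φ).symm
  exact hom_ext h

end Closed

end FdOS

/-! ### The theorem -/

theorem mainTheorem1 :
    -- the zero-dimensional space is both terminal and initial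
    IsZero FdOS.zero ∧
    -- `X ⊕^∞ Y`, with the coordinate projections, is the product of `X` and `Y`
    (∀ X Y : FdOS, ∃ (p : FdOS.linftySum X Y ⟶ X) (q : FdOS.linftySum X Y ⟶ Y),
      p.lin = LinearMap.fst ℂ X Y ∧ q.lin = LinearMap.snd ℂ X Y ∧
        Nonempty (IsLimit (BinaryFan.mk p q))) ∧
    -- `X ⊕^1 Y`, with the coordinate injections, is the coproduct of `X` and `Y`
    (∀ X Y : FdOS, ∃ (i : X ⟶ FdOS.loneSum X Y) (j : Y ⟶ FdOS.loneSum X Y),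
      i.lin = LinearMap.inl ℂ X Y ∧ j.lin = LinearMap.inr ℂ X Y ∧
        Nonempty (IsColimit (BinaryCofan.mk i j))) ∧
    -- both tensor products are symmetric monoidal with unit `ℂ`
    ∃ (hproj : FdOS.IsSymmetricMonoidal FdOS.projOSS)
      (hinj : FdOS.IsSymmetricMonoidal FdOS.injOSS),
      letI : MonoidalCategory FdOS := hproj.monoidalCategory
      letI : SymmetricCategory FdOS := hproj.symmetricCategory
      -- the completely projective one is closed, with internal hom `CB(X, Y)`
      ∃ H : InternalHom FdOS FdOS.CB,
        (∀ X Y : FdOS, (H.ev X Y).lin = FdOS.evalMap X Y) ∧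
        letI : MonoidalClosed FdOS := H.monoidalClosed
        -- the resulting category is `*`-autonomous with dualizing object `ℂ` and models MALL
        IsMALLModel FdOS.complex ∧
        -- its par is the completely injective tensor product
        ∃ e : ∀ X Y : FdOS, FdOS.injTensor X Y ≅ par FdOS.complex X Y,
          (∀ X Y : FdOS, (e X Y).hom.lin = FdOS.toHomDual X Y) ∧
          ∀ {X X' Y Y' : FdOS} (f : X ⟶ X') (g : Y ⟶ Y'),
            hinj.tensorMap f g ≫ (e X' Y').hom = (e X Y).hom ≫ parMap FdOS.complex f g := by
  refine ⟨FdOS.isZero_zero,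
    fun X Y => ⟨FdOS.linftyFst X Y, FdOS.linftySnd X Y, rfl, rfl, ⟨FdOS.linftyIsLimit X Y⟩⟩,
    fun X Y => ⟨FdOS.loneInl X Y, FdOS.loneInr X Y, rfl, rfl, ⟨FdOS.loneIsColimit X Y⟩⟩,
    FdOS.isSymmetricMonoidal_proj, FdOS.isSymmetricMonoidal_inj, FdOS.internalHom,
    fun _ _ => rfl, FdOS.isMALLModel, FdOS.parIso, FdOS.parIso_hom_lin, FdOS.parIso_naturality⟩
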